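/- Setting. Let $H$ be a separable real Hilbert space, $X$ a random variable with values in a measurable space $\mathcal X$, and $g:\mathcal X\times H\to\mathbb R$ such that $g(X,h)$ is integrable for every $h\in H$ and, for almost every $x$, $g(x,\cdot)$ is Fréchet-differentiable with gradient $\nabla_h g(x,\cdot)$ (jointly measurable in $(x,h)$). Assume that $G(h):=\mathbb E[g(X,h)]$ is convex on $H$. Write $\Gamma_h$ for the Hessian of $G$ at $h$ (the Fréchet derivative of $\nabla G$ at $h$) wherever it exists, and $\mathcal B(m,r)$ for the ball of centre $m$ and radius $r$. Assume: * (H1) $G$ is differentiable on $H$, and $m\in H$ satisfies $\nabla G(m)=0$. * (H2) $G$ is twice continuously differentiable almost everywhere (off a Haar-null set, i.e. a Lebesgue-null set when $\dim H<\infty$, $\Gamma_h$ exists and is continuous in $h$), and for every $A>0$ there is $C_A>0$ with $\|\Gamma_h\|_{op}\le C_A$ for all $h\in\mathcal B(m,A)$ at which $\Gamma_h$ exists. * (H3) $C_m>0$ is a constant with $\|\nabla G(h)-\Gamma_m(h-m)\|\le C_m\|h-m\|^2$ for all $h\in H$. * (H7) $\Gamma_m$ exists, the infimum $\lambda_{\min}$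 of its eigenvalues is positive, and there is $\epsilon>0$ such that, for all $h\in\mathcal B(m,\epsilon)$ at which $\Gamma_h$ exists, $H$ has a Hilbert basis composed of eigenvectors of $\Gamma_h$ and all eigenvalues of $\Gamma_h$ are at least $\lambda_{\min}/2$. * (H8) $(L_q)_{q\ge1}$ are positive constants with $\mathbb E\big[\|\nabla_h g(X,h)\|^{2q}\big]\le L_q\,(1+\|h-m\|^{2q})$ (in particular, the left side is finite) for all integers $q\ge1$ and all $h\in H$. Let $c_\gamma>0$, $\alpha\in(\tfrac12,1)$, $\gamma_k:=c_\gamma k^{-\alpha}$, and $R\in\mathbb R$. For $p\ge1$ machines, let $X_{i,k}$ ($1\le i\le p$, $k\ge1$) be independent random variables with the law of $X$, and let $m_{1,1},\dots,m_{p,1}$ be $H$-valued random variables, almost surely bounded in norm by $R$, whose family is independent of the family $(X_{i,k})_{1\le i\le p,\,k\ge2}$. For $k\ge1$ put $$m_{i,k+1}=m_{i,k}-\gamma_k\nabla_h g(X_{i,k+1},m_{i,k}),\qquad \overline m_{i,k+1}=\overline m_{i,k}+\tfrac1{k+1}(m_{i,k+1}-\overline m_{i,k}),\qquad \overline m_{i,1}=m_{i,1},$$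 and, for integers $n_1,\dots,n_p\ge1$ and $n=\sum_{i=1}^p n_i$, put $\widehat m_n:=\frac1n\sum_{i=1}^p n_i\,\overline m_{i,n_i}$. Theorem. There are positive constants $C_1,C_2$, which depend neither on $p$, nor on $n_1,\dots,n_p$, nor on the data and the starting points (except through the law of $X$ and $R$), such that for all $i$ and all $k\ge1$ $$\mathbb E\big[\|m_{i,k}-m\|^2\big]\le\frac{C_1}{k^\alpha},\qquad \mathbb E\big[\|m_{i,k}-m\|^4\big]\le\frac{C_2}{k^{2\alpha}},$$ and such that for all $p\ge1$, all $n_1,\dots,n_p\ge1$ and $n=\sum_{i=1}^p n_i$, $$\mathbb E\big[\|\widehat m_n-m\|^2\big]\le\frac{L_1\lambda_{\min}^{-2}}{n}+\sum_{j=1}^5\lambda_{\min}^{-2}A_{j,p,n}^2+\sum_{\substack{j,j'=1\\ j\ne j'}}^6\lambda_{\min}^{-2}A_{j,p,n}A_{j',p,n},$$ where the $A_{j,p,n}\ge0$ are given by $$A_{1,p,n}^2=A_{2,p,n}^2=\frac{p^2C_1c_\gamma^{-2}}{n^2},\quad A_{3,p,n}^2=\frac{4p^{2-\alpha}\alpha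 c_\gamma^{-2}C_1}{n^{2-\alpha}},\quad A_{4,p,n}^2=\frac{C_m^2C_2(1-\alpha)^{-2}p^{2\alpha}}{n^{2\alpha}},$$ $$A_{5,p,n}^2=\frac{L_1C_1(1-\alpha)^{-1}p^\alpha}{n^{1+\alpha}},\quad A_{6,p,n}^2=\frac{L_1}{n}.$$ Moreover, $$\mathbb E\big[\|\widehat m_n-m\|^2\big]\le\frac{L_1\lambda_{\min}^{-2}}{n}+o\Big(\frac1n\Big)\qquad(n\to\infty),$$ where the remainder depends only on $p$ and $n$ (and on the setting and $R$), and is $o(1/n)$ for fixed $p$ and, more generally, for $p=p(n)=o(n^\kappa)$ with $\kappa=\min\{\frac{2\alpha-1}{2\alpha},\frac{1-\alpha}{2-\alpha}\}$. -/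

import Mathlib

open MeasureTheory ProbabilityTheory Filter Topology Asymptotics

noncomputable section

/-- The objective function `G(h) = E[g(X, h)]`, where `μ` is the law of `X`. -/
def objective {𝒳 H : Type*} [MeasurableSpace 𝒳] (μ : Measure 𝒳) (g : 𝒳 → H → ℝ) (h : H) : ℝ :=
  ∫ x, g x h ∂μ

/-- The Hessian `Γ_h` of `G` at `h`: the Fréchet derivative at `h` of the gradient of `G`. -/
def hessian {H : Type*} [NormedAddCommGroup H] [InnerProductSpace ℝ H] [CompleteSpace H]
    (G : H → ℝ) (h : H) : H →L[ℝ] H :=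
  fderiv ℝ (gradient G) h

/-- `N` is negligible in the sense of Christensen (Haar null): some Borel probability measure
gives mass zero to every translate of some Borel set containing `N`. If `H` has finite dimension,
these are exactly the Lebesgue null sets. -/
def IsHaarNull {H : Type*} [NormedAddCommGroup H] [MeasurableSpace H] (N : Set H) : Prop :=
  ∃ B : Set H, MeasurableSet B ∧ N ⊆ B ∧
    ∃ ν : Measure H, IsProbabilityMeasure ν ∧ ∀ h : H, ν ((fun y => h + y) ⁻¹' B) = 0

/-- `G`, assumed differentiable, is twice continuously differentiable almost everywhere: off a
negligible set, the Hessian exists and is continuous. -/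
def TwiceContDiffAE {H : Type*} [NormedAddCommGroup H] [InnerProductSpace ℝ H] [CompleteSpace H]
    [MeasurableSpace H] (G : H → ℝ) : Prop :=
  ∃ N : Set H, IsHaarNull N ∧ (∀ h ∉ N, DifferentiableAt ℝ (gradient G) h) ∧
    ContinuousOn (hessian G) Nᶜ

/-- `lam` is an eigenvalue of the bounded operator `T`. -/
def IsEigenvalue {H : Type*} [NormedAddCommGroup H] [InnerProductSpace ℝ H]
    (T : H →L[ℝ] H) (lam : ℝ) : Prop :=
  ∃ v : H, v ≠ 0 ∧ T v = lam • v

/-- `H` has a (Hilbert) basis composed of eigenvectors of `T`. -/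
def HasEigenbasis {H : Type*} [NormedAddCommGroup H] [InnerProductSpace ℝ H] [CompleteSpace H]
    (T : H →L[ℝ] H) : Prop :=
  ∃ (s : Set H) (b : HilbertBasis s ℝ H), ∀ i : s, ∃ lam : ℝ, T (b i) = lam • b i

/-- The infimum of the eigenvalues of `T`. -/
def lambdaMin {H : Type*} [NormedAddCommGroup H] [InnerProductSpace ℝ H] (T : H →L[ℝ] H) : ℝ :=
  sInf {lam : ℝ | IsEigenvalue T lam}

/-- Local strong convexity of `G` near `m`. The Hessian `Γ_m` exists, the infimum of its
eigenvalues is positive and, for all `h` in some ball around `m` where the Hessian `Γ_h` exists,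
`Γ_h` has a basis of eigenvectors and its eigenvalues are at least `λ_min / 2`. -/
def LocallyStronglyConvexAt {H : Type*} [NormedAddCommGroup H] [InnerProductSpace ℝ H]
    [CompleteSpace H] (G : H → ℝ) (m : H) : Prop :=
  DifferentiableAt ℝ (gradient G) m ∧ 0 < lambdaMin (hessian G m) ∧
    ∃ ε : ℝ, 0 < ε ∧ ∀ h ∈ Metric.ball m ε, DifferentiableAt ℝ (gradient G) h →
      HasEigenbasis (hessian G h) ∧
        ∀ lam : ℝ, IsEigenvalue (hessian G h) lam → lambdaMin (hessian G m) / 2 ≤ lam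

/-- The step size `γ_k = c_γ k ^ (-α)`. -/
def stepSize (cγ α : ℝ) (k : ℕ) : ℝ := cγ * (k : ℝ) ^ (-α)

/-- The stochastic gradient iterates `m_{k+1} = m_k - γ_k ∇_h g(x_{k+1}, m_k)` for `k ≥ 1`,
started at `m_1 = m₁` (the value at index `0` is a convention that plays no role). -/
def sgd {𝒳 H : Type*} [NormedAddCommGroup H] [InnerProductSpace ℝ H] [CompleteSpace H]
    (g : 𝒳 → H → ℝ) (cγ α : ℝ) (m₁ : H) (x : ℕ → 𝒳) : ℕ → H
  | 0 => m₁
  | 1 => m₁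
  | k + 2 => sgd g cγ α m₁ x (k + 1)
      - stepSize cγ α (k + 1) • gradient (g (x (k + 2))) (sgd g cγ α m₁ x (k + 1))

/-- The averaged iterates: `a_1 = u_1` and `a_{k+1} = a_k + (u_{k+1} - a_k) / (k + 1)` for `k ≥ 1`
(the value at index `0` is a convention that plays no role). -/
def runningAverage {H : Type*} [NormedAddCommGroup H] [InnerProductSpace ℝ H] (u : ℕ → H) : ℕ → H
  | 0 => u 1
  | 1 => u 1
  | k + 2 => runningAverage u (k + 1)
      + (1 / ((k : ℝ) + 2)) • (u (k + 2) - runningAverage u (k + 1))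

/-- The parallelized averaged stochastic gradient estimate of `p` machines, machine `i` being
started at `m₁ i` and having treated the data `x i` up to index `n i`. -/
def pasg {𝒳 H : Type*} [NormedAddCommGroup H] [InnerProductSpace ℝ H] [CompleteSpace H]
    (g : 𝒳 → H → ℝ) (cγ α : ℝ) {p : ℕ} (m₁ : Fin p → H) (x : Fin p → ℕ → 𝒳) (n : Fin p → ℕ) : H :=
  (1 / ((∑ i, n i : ℕ) : ℝ)) •
    ∑ i, (n i : ℝ) • runningAverage (sgd g cγ α (m₁ i) (x i)) (n i)

/-- The data and the starting points of `p` machines. The data `X_{i,k}`, `1 ≤ i ≤ p`, `k ≥ 1`, are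
independent with law `μ`; the starting points are random variables bounded by `R` that do not
depend on the data `X_{i,k}`, `k ≥ 2`, entering the algorithm (they may depend on `X_{i,1}`). -/
structure IsMachineData {Ω 𝒳 H : Type*} [MeasurableSpace Ω] [MeasurableSpace 𝒳]
    [NormedAddCommGroup H] [MeasurableSpace H] (P : Measure Ω) (μ : Measure 𝒳) (R : ℝ) {p : ℕ}
    (X : Fin p → ℕ → Ω → 𝒳) (m₁ : Fin p → Ω → H) : Prop where
  measurable_data : ∀ i k, 1 ≤ k → Measurable (X i k)
  law_data : ∀ i k, 1 ≤ k → P.map (X i k) = μ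
  indep_data : iIndepFun (fun q : Fin p × ℕ => X q.1 (q.2 + 1)) P
  measurable_start : ∀ i, Measurable (m₁ i)
  bounded_start : ∀ i, ∀ᵐ ω ∂P, ‖m₁ i ω‖ ≤ R
  indep_start : IndepFun (fun ω i => m₁ i ω) (fun ω (q : Fin p × ℕ) => X q.1 (q.2 + 2) ω) P

/-- The squares `A_{1,p,n}², …, A_{6,p,n}²` (at the indices `0, …, 5`). -/
def remainderSq (cγ α Cm L₁ C₁ C₂ : ℝ) (p n : ℕ) : Fin 6 → ℝ :=
  ![(p : ℝ) ^ 2 * C₁ * cγ ^ (-2 : ℤ) / (n : ℝ) ^ 2,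
    (p : ℝ) ^ 2 * C₁ * cγ ^ (-2 : ℤ) / (n : ℝ) ^ 2,
    4 * (p : ℝ) ^ (2 - α) * α * cγ ^ (-2 : ℤ) * C₁ / (n : ℝ) ^ (2 - α),
    Cm ^ 2 * C₂ * (1 - α) ^ (-2 : ℤ) * (p : ℝ) ^ (2 * α) / (n : ℝ) ^ (2 * α),
    L₁ * C₁ * (1 - α)⁻¹ * (p : ℝ) ^ α / (n : ℝ) ^ (1 + α),
    L₁ / (n : ℝ)]

/-- The explicit bound
`L₁ λ⁻² / n + ∑_{j=1}^5 λ⁻² A_j² + ∑_{j ≠ j', 1 ≤ j, j' ≤ 6} λ⁻² A_j A_{j'}`. -/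
def quadraticBound (lam cγ α Cm L₁ C₁ C₂ : ℝ) (p n : ℕ) : ℝ :=
  L₁ * lam ^ (-2 : ℤ) / (n : ℝ)
    + ∑ j : Fin 5, lam ^ (-2 : ℤ) * remainderSq cγ α Cm L₁ C₁ C₂ p n j.castSucc
    + ∑ j : Fin 6, ∑ j' ∈ Finset.univ.erase j,
        lam ^ (-2 : ℤ) * √(remainderSq cγ α Cm L₁ C₁ C₂ p n j)
          * √(remainderSq cγ α Cm L₁ C₁ C₂ p n j')

end

/-! The proof has two stages: moment bounds for one machine, then a linearisation of the averaged
recursion over all machines.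

Moments. Expanding ‖m_{k+1} - m‖^(2q+2) and integrating out the new data item gives a recursion
whose drift is -γ_k ‖m_k - m‖^(2q) ⟨m_k - m, ∇G(m_k)⟩, up to a factor. Near m, (H3) and the
positivity of Γ_m make this inner product at least (λ_min/2)‖h - m‖²; far from m, convexity gives
only linear growth, so there is no uniform contraction. `exists_coercive_gradient` interpolates: at
every truncation level M the contraction has strength 1/M, up to an error carried by a higher moment
and small in M. Dropping the drift, all moments are bounded because ∑ γ_k² is finite. With M = k^δ,
an induction on the exponent (`IsMomentSystem.exists_rate_lt`) yields every rate slightly below the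
sharp one. These rates control the next moment well enough to take M = 1, which gives the sharp
rates k^(-α) and k^(-2α) (`IsMomentSystem.exists_rates`).

Averaging. Dividing one step by γ_k writes Γ_m(m_k - m) as (m_k - m_{k+1})/γ_k, minus a quadratic
remainder, minus centred noise. After summation over k and over the machines, Abel summation and the
second moments control the first part and the fourth moments the remainder. The noises of different
steps or machines are orthogonal in L², so their variances add up: this yields the leading term
L₁/n. Since ‖Γ_m v‖ ≥ λ_min‖v‖, Minkowski's inequality bounds the L² error by λ_min⁻¹ ∑ A_j, whose
square is exactly `quadraticBound`. Only A_6 has order n^(-1/2), so every other term of the square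
is o(1/n).

The identity ∇G = E[∇g(X, ·)] is derived from (H8) with q = 1: difference quotients are bounded in
L², hence uniformly integrable (`gradient_objective_eq_integral`). -/

open scoped RealInnerProductSpace

/-! ### Scalar recursive inequalities -/

/-- A nonnegative bounded sequence contracted at rate `c k ^ (-a)`, `a < 1`, up to an error
`K k ^ (-a - r)`, decays like `k ^ (-r)`, with a constant that depends only on the parameters. -/
theorem exists_rate_of_recursion {a r c K U : ℝ} (ha : 0 < a) (ha1 : a < 1) (hr : 0 ≤ r)
    (hc : 0 < c) (hK : 0 ≤ K) (hU : 0 ≤ U) :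
    ∃ B : ℝ, 0 < B ∧ ∀ u : ℕ → ℝ, (∀ k, 1 ≤ k → u k ≤ U) →
      (∀ k : ℕ, 1 ≤ k → u (k + 1) ≤ (1 - c * (k : ℝ) ^ (-a)) * u k + K * (k : ℝ) ^ (-a - r)) →
      ∀ k : ℕ, 1 ≤ k → u k ≤ B * (k : ℝ) ^ (-r) := by
  have h1 : ∀ᶠ k : ℕ in atTop, c * (k : ℝ) ^ (-a) ≤ 1 := by
    have : Tendsto (fun k : ℕ => c * (k : ℝ) ^ (-a)) atTop (𝓝 (c * 0)) :=
      ((tendsto_rpow_neg_atTop ha).comp tendsto_natCast_atTop_atTop).const_mul c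
    rw [mul_zero] at this
    exact this.eventually_le_const one_pos
  -- As a < 1, the decrement r k^(-r-1) of the target rate is eventually at most half of the
  -- contraction c k^(-a-r); the other half is left to absorb K.
  have h2 : ∀ᶠ k : ℕ in atTop, r * (k : ℝ) ^ (-(1 - a)) ≤ c / 2 := by
    have : Tendsto (fun k : ℕ => r * (k : ℝ) ^ (-(1 - a))) atTop (𝓝 (r * 0)) :=
      ((tendsto_rpow_neg_atTop (by linarith)).comp tendsto_natCast_atTop_atTop).const_mul r
    rw [mul_zero] at this
    exact this.eventually_le_const (by positivity)
  obtain ⟨k₀, hk₀⟩ := eventually_atTop.1 (h1.and (h2.and (eventually_ge_atTop 1)))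
  have hk01 : 1 ≤ k₀ := (hk₀ k₀ le_rfl).2.2
  -- The first summand covers k ≤ k₀ through the a priori bound U, the second gives K ≤ c B / 2, and
  -- the last makes B positive.
  set B : ℝ := U * (k₀ : ℝ) ^ r + 2 * K / c + 1 with hB
  have hk0r : (0 : ℝ) ≤ (k₀ : ℝ) ^ r := by positivity
  have hBpos : 0 < B := by positivity
  refine ⟨B, hBpos, fun u hu hrec => ?_⟩
  have small : ∀ k : ℕ, 1 ≤ k → k ≤ k₀ → u k ≤ B * (k : ℝ) ^ (-r) := by
    intro k hk hkk
    have hkpos : (0 : ℝ) < k := by exact_mod_cast hk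
    refine (hu k hk).trans ?_
    rw [Real.rpow_neg hkpos.le, ← div_eq_mul_inv, le_div_iff₀ (by positivity)]
    have : (k : ℝ) ^ r ≤ (k₀ : ℝ) ^ r :=
      Real.rpow_le_rpow hkpos.le (by exact_mod_cast hkk) hr
    have h3 : U * (k : ℝ) ^ r ≤ U * (k₀ : ℝ) ^ r := by gcongr
    have : 0 ≤ 2 * K / c := by positivity
    linarith
  intro k hk
  rcases le_total k k₀ with hkk | hkk
  · exact small k hk hkk
  induction k, hkk using Nat.le_induction with
  | base => exact small _ hk le_rfl
  | succ k hkk ih =>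
    have hk1 : 1 ≤ k := hk01.trans hkk
    obtain ⟨e1, e2, -⟩ := hk₀ k hkk
    have ih := ih hk1
    have hkpos : (0 : ℝ) < k := by exact_mod_cast hk1
    have hstep : (k : ℝ) ^ (-r) - ((k + 1 : ℕ) : ℝ) ^ (-r) ≤ r * (k : ℝ) ^ (-r - 1) := by
      -- Bernoulli's inequality for the nonpositive exponent -r, from log x ≤ x - 1 and 1 + x ≤ exp
      -- x.
      have hb : 1 + (-r) * (1 / (k : ℝ)) ≤ (1 + 1 / (k : ℝ)) ^ (-r) := by
        rw [Real.rpow_def_of_pos (by positivity)]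
        have h5 := Real.log_le_sub_one_of_pos (x := 1 + 1 / (k : ℝ)) (by positivity)
        have h6 := Real.add_one_le_exp (Real.log (1 + 1 / (k : ℝ)) * -r)
        nlinarith
      have he : ((k + 1 : ℕ) : ℝ) = k * (1 + 1 / (k : ℝ)) := by
        push_cast; field_simp
      rw [he, Real.mul_rpow hkpos.le (by positivity), Real.rpow_sub_one hkpos.ne']
      have := mul_le_mul_of_nonneg_left hb (Real.rpow_nonneg hkpos.le (-r))
      calc _ ≤ (k : ℝ) ^ (-r) - (k : ℝ) ^ (-r) * (1 + (-r) * (1 / (k : ℝ))) := by linarith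
        _ = _ := by field_simp; ring
    have hx : (0 : ℝ) ≤ (k : ℝ) ^ (-a - r) := by positivity
    have hs1 : (k : ℝ) ^ (-a) * (k : ℝ) ^ (-r) = (k : ℝ) ^ (-a - r) := by
      rw [← Real.rpow_add hkpos]; ring_nf
    have hs2 : (k : ℝ) ^ (-(1 - a)) * (k : ℝ) ^ (-a - r) = (k : ℝ) ^ (-r - 1) := by
      rw [← Real.rpow_add hkpos]; ring_nf
    have h3 : u (k + 1) ≤ (1 - c * (k : ℝ) ^ (-a)) * (B * (k : ℝ) ^ (-r))
        + K * (k : ℝ) ^ (-a - r) := by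
      refine (hrec k hk1).trans ?_
      have : 0 ≤ 1 - c * (k : ℝ) ^ (-a) := by linarith
      gcongr
    have h4 : r * (k : ℝ) ^ (-r - 1) ≤ c / 2 * (k : ℝ) ^ (-a - r) := by
      rw [← hs2, ← mul_assoc]
      gcongr
    have h5 : K ≤ c / 2 * B := by
      have : c / 2 * (2 * K / c) = K := by field_simp
      have h6 : 2 * K / c ≤ B := by rw [hB]; have := mul_nonneg hU hk0r; linarith
      calc K = c / 2 * (2 * K / c) := this.symm
        _ ≤ _ := by gcongr
    have h6 : K * (k : ℝ) ^ (-a - r) ≤ c / 2 * B * (k : ℝ) ^ (-a - r) := by gcongr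
    have h7 : B * ((k : ℝ) ^ (-r) - ((k + 1 : ℕ) : ℝ) ^ (-r))
        ≤ B * (c / 2 * (k : ℝ) ^ (-a - r)) := by
      gcongr; exact hstep.trans h4
    have h8 : (1 - c * (k : ℝ) ^ (-a)) * (B * (k : ℝ) ^ (-r))
        = B * (k : ℝ) ^ (-r) - c * B * (k : ℝ) ^ (-a - r) := by
      rw [← hs1]; ring
    rw [h8] at h3
    nlinarith [h3, h6, h7]

/-- A discrete Grönwall bound with a summable rate. -/
theorem exists_bound_of_recursion {s K U : ℝ} (hs : 1 < s) (hK : 0 ≤ K) :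
    ∃ B : ℝ, 0 < B ∧ ∀ u : ℕ → ℝ, (∀ k, 1 ≤ k → 0 ≤ u k) → u 1 ≤ U →
      (∀ k : ℕ, 1 ≤ k → u (k + 1) ≤ u k + K * (k : ℝ) ^ (-s) * (1 + u k)) →
      ∀ k : ℕ, 1 ≤ k → u k ≤ B := by
  have hsum : Summable (fun k : ℕ => (k : ℝ) ^ (-s)) := Real.summable_nat_rpow.2 (by linarith)
  refine ⟨(1 + |U|) * Real.exp (K * ∑' k : ℕ, (k : ℝ) ^ (-s)), by positivity,
    fun u hu h1 hrec k hk => ?_⟩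
  have key : ∀ k : ℕ, 1 ≤ k →
      1 + u k ≤ (1 + |U|) * Real.exp (K * ∑ j ∈ Finset.range k, (j : ℝ) ^ (-s)) := by
    intro k hk
    induction k, hk using Nat.le_induction with
    | base =>
      have : 1 ≤ Real.exp (K * ∑ j ∈ Finset.range 1, (j : ℝ) ^ (-s)) := by
        apply Real.one_le_exp; positivity
      have hh : 1 + u 1 ≤ 1 + |U| := by linarith [le_abs_self U]
      calc _ ≤ (1 + |U|) * 1 := by linarith
        _ ≤ _ := by gcongr
    | succ k hk ih =>
      have h0 : 0 ≤ 1 + u k := by linarith [hu k hk]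
      rw [Finset.sum_range_succ, mul_add, Real.exp_add, ← mul_assoc]
      calc 1 + u (k + 1) ≤ (1 + u k) * (K * (k : ℝ) ^ (-s) + 1) := by linarith [hrec k hk]
        _ ≤ _ := by gcongr; exact Real.add_one_le_exp _
  have h2 : (1 + |U|) * Real.exp (K * ∑ j ∈ Finset.range k, (j : ℝ) ^ (-s))
      ≤ (1 + |U|) * Real.exp (K * ∑' k : ℕ, (k : ℝ) ^ (-s)) := by
    gcongr
    exact hsum.sum_le_tsum _ (fun i _ => by positivity)
  linarith [key k hk]

/-! ### Coupled recursions for the moments -/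

/-- The recursive inequalities between the moments `w q k = E ‖m_k - m‖ ^ (2 q)` of a stochastic
gradient algorithm. The parameter `M ≥ 1` is a truncation level. -/
structure IsMomentSystem (c E α : ℝ) (K U : ℕ → ℝ) (w : ℕ → ℕ → ℝ) : Prop where
  nonneg : ∀ q k, 1 ≤ k → 0 ≤ w q k
  zero : ∀ k, 1 ≤ k → w 0 k = 1
  le_succ : ∀ q k, 1 ≤ k → w q k ≤ 1 + w (q + 1) k
  init : ∀ q, w q 1 ≤ U q
  step : ∀ q s k : ℕ, ∀ M : ℝ, 1 ≤ k → 1 ≤ M →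
    w (q + 1) (k + 1) ≤ w (q + 1) k
      - c / M * (k : ℝ) ^ (-α) * (w (q + 1) k - (E / M ^ 2) ^ s * w (q + 1 + s) k)
      + K q * (k : ℝ) ^ (-(2 * α)) * (w q k + w (q + 1) k)
      + K q * (k : ℝ) ^ (-(2 * α * (q + 1)))

theorem rpow_neg_le_rpow_neg {k : ℕ} (hk : 1 ≤ k) {s t : ℝ} (h : t ≤ s) :
    (k : ℝ) ^ (-s) ≤ (k : ℝ) ^ (-t) :=
  Real.rpow_le_rpow_of_exponent_le (by exact_mod_cast hk) (by linarith)

/-- With s = 0 and M = 1 the drift term cancels, and what remains grows at the rate k^(-2α),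
summable because 2α > 1. -/
theorem IsMomentSystem.exists_bound {c E α : ℝ} {K U : ℕ → ℝ} (hα : 1 / 2 < α)
    (hK : ∀ q, 0 ≤ K q) (q : ℕ) :
    ∃ B : ℝ, 0 < B ∧ ∀ w, IsMomentSystem c E α K U w → ∀ k, 1 ≤ k → w q k ≤ B := by
  cases q with
  | zero => exact ⟨1, one_pos, fun w hw k hk => (hw.zero k hk).le⟩
  | succ q =>
    obtain ⟨B, hB, h⟩ := exists_bound_of_recursion (s := 2 * α) (K := 3 * K q) (U := U (q + 1))
      (by linarith) (by have := hK q; positivity)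
    refine ⟨B, hB, fun w hw => h (w (q + 1)) (fun k hk => hw.nonneg _ k hk) (hw.init _)
      (fun k hk => ?_)⟩
    have h1 := hw.step q 0 k 1 hk le_rfl
    simp only [pow_zero, add_zero, one_mul, sub_self, mul_zero, sub_zero] at h1
    have h2 := hw.le_succ q k hk
    have h3 := hw.nonneg (q + 1) k hk
    have h4 : (k : ℝ) ^ (-(2 * α * (q + 1))) ≤ (k : ℝ) ^ (-(2 * α)) := by
      apply rpow_neg_le_rpow_neg hk
      have : (0 : ℝ) ≤ q := by positivity
      nlinarith
    have h5 : K q * (k : ℝ) ^ (-(2 * α * (q + 1))) ≤ K q * (k : ℝ) ^ (-(2 * α)) :=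
      mul_le_mul_of_nonneg_left h4 (hK q)
    have h6 : 0 ≤ K q * (k : ℝ) ^ (-(2 * α)) := mul_nonneg (hK q) (by positivity)
    nlinarith [mul_le_mul_of_nonneg_left h2 h6, mul_nonneg h6 h3]

/-- Each induction step on j gains a factor k^(-β). The truncation level k^δ, δ = α - β, weakens the
contraction to k^(-α-δ), still of exponent below 1, while boundedness of a sufficiently high moment
makes the truncation error negligible. The remaining terms inherit the rate already known for the
orders q and q + 1. -/
theorem IsMomentSystem.exists_rate_lt {c E α β : ℝ} {K U : ℕ → ℝ} (hc : 0 < c) (hE : 0 ≤ E)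
    (hα : 1 / 2 < α) (hβ : 0 < β) (hβα : β < α) (hαβ : 2 * α - β < 1) (hK : ∀ q, 0 ≤ K q)
    (j q : ℕ) (hjq : j ≤ q) :
    ∃ B : ℝ, 0 < B ∧ ∀ w, IsMomentSystem c E α K U w →
      ∀ k : ℕ, 1 ≤ k → w q k ≤ B * (k : ℝ) ^ (-(j * β)) := by
  induction j generalizing q with
  | zero =>
    obtain ⟨B, hB, h⟩ := IsMomentSystem.exists_bound (c := c) (E := E) (U := U) hα hK q
    exact ⟨B, hB, fun w hw k hk => by simpa using h w hw k hk⟩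
  | succ j ih =>
    obtain ⟨q, rfl⟩ : ∃ q', q = q' + 1 := ⟨q - 1, by omega⟩
    set δ := α - β with hδ
    have hδ0 : 0 < δ := by linarith
    -- This s makes the truncation factor k^(-2δs) at most k^(-(j+1)β).
    obtain ⟨s, hs⟩ := exists_nat_ge (((j : ℝ) + 1) * β / (2 * δ))
    have hs : ((j : ℝ) + 1) * β ≤ 2 * δ * s := by
      rw [div_le_iff₀ (by positivity)] at hs; linarith
    obtain ⟨B₁, hB₁, h₁⟩ := ih q (by omega)
    obtain ⟨B₂, hB₂, h₂⟩ := ih (q + 1) (by omega)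
    obtain ⟨B₃, hB₃, h₃⟩ := IsMomentSystem.exists_bound (c := c) (E := E) (U := U) hα hK (q + 1 + s)
    obtain ⟨B₄, hB₄, h₄⟩ := IsMomentSystem.exists_bound (c := c) (E := E) (U := U) hα hK (q + 1)
    have hKq := hK q
    obtain ⟨B, hB, h⟩ := exists_rate_of_recursion (a := α + δ) (r := (j + 1 : ℝ) * β) (c := c)
      (K := c * E ^ s * B₃ + K q * (B₁ + B₂) + K q) (U := B₄) (by linarith) (by linarith)
      (by positivity) hc (by positivity) hB₄.le
    refine ⟨B, hB, fun w hw k hk => ?_⟩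
    have := h (w (q + 1)) (h₄ w hw) (fun k hk => ?_) k hk
    · simpa using this
    have hkpos : (0 : ℝ) < k := by exact_mod_cast hk
    have hk1 : (1 : ℝ) ≤ k := by exact_mod_cast hk
    have hst := hw.step q s k ((k : ℝ) ^ δ) hk (Real.one_le_rpow hk1 hδ0.le)
    have e1 : c / (k : ℝ) ^ δ * (k : ℝ) ^ (-α) = c * (k : ℝ) ^ (-(α + δ)) := by
      rw [neg_add, Real.rpow_add hkpos, Real.rpow_neg hkpos.le δ]; ring
    have e2 : (E / ((k : ℝ) ^ δ) ^ 2) ^ s = E ^ s * (k : ℝ) ^ (-(2 * δ * s)) := by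
      rw [div_pow, ← pow_mul, ← Real.rpow_natCast ((k : ℝ) ^ δ), ← Real.rpow_mul hkpos.le,
        div_eq_mul_inv, ← Real.rpow_neg hkpos.le]
      push_cast; ring_nf
    rw [e1, e2] at hst
    set x := (k : ℝ) ^ (-(α + δ) - (j + 1) * β) with hx
    have f1 : c * (k : ℝ) ^ (-(α + δ)) * (E ^ s * (k : ℝ) ^ (-(2 * δ * s)) * w (q + 1 + s) k)
        ≤ c * E ^ s * B₃ * x := by
      have : (k : ℝ) ^ (-(2 * δ * s)) ≤ (k : ℝ) ^ (-((j + 1) * β)) := rpow_neg_le_rpow_neg hk hs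
      calc _ ≤ c * (k : ℝ) ^ (-(α + δ)) * (E ^ s * (k : ℝ) ^ (-((j + 1) * β)) * B₃) := by
            gcongr
            · exact hw.nonneg _ _ hk
            · exact h₃ w hw k hk
        _ = _ := by rw [hx, sub_eq_add_neg, Real.rpow_add hkpos]; ring
    -- The exponents balance because δ + β = α: the noise term k^(-2α) k^(-jβ) has exactly the size
    -- allowed by the contraction for the exponent (j + 1)β.
    have ex : x = (k : ℝ) ^ (-(2 * α)) * (k : ℝ) ^ (-(j * β)) := by
      rw [hx, ← Real.rpow_add hkpos]; congr 1; rw [hδ]; ring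
    have f2 : K q * (k : ℝ) ^ (-(2 * α)) * (w q k + w (q + 1) k) ≤ K q * (B₁ + B₂) * x := by
      calc _ ≤ K q * (k : ℝ) ^ (-(2 * α)) *
            (B₁ * (k : ℝ) ^ (-(j * β)) + B₂ * (k : ℝ) ^ (-(j * β))) := by
            gcongr
            · exact h₁ w hw k hk
            · exact h₂ w hw k hk
        _ = _ := by rw [ex]; ring
    have f3 : K q * (k : ℝ) ^ (-(2 * α * (q + 1))) ≤ K q * x := by
      gcongr
      rw [ex, ← Real.rpow_add hkpos, ← neg_add]
      apply rpow_neg_le_rpow_neg hk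
      have hjq' : (j : ℝ) ≤ q := by exact_mod_cast (by omega : j ≤ q)
      have hj0 : (0 : ℝ) ≤ j := by positivity
      nlinarith [mul_le_mul hjq' hβα.le hβ.le (hj0.trans hjq')]
    nlinarith [f1, f2, f3, hst]

/-- The second and fourth moments decay at the rates `k ^ (-α)` and `k ^ (-2 α)`. -/
theorem IsMomentSystem.exists_rates {c E α : ℝ} {K U : ℕ → ℝ} (hc : 0 < c) (hE : 0 ≤ E)
    (hα : 1 / 2 < α) (hα' : α < 1) (hK : ∀ q, 0 ≤ K q) :
    ∃ B₁ : ℝ, 0 < B₁ ∧ ∃ B₂ : ℝ, 0 < B₂ ∧ ∀ w, IsMomentSystem c E α K U w →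
      ∀ k : ℕ, 1 ≤ k → w 1 k ≤ B₁ * (k : ℝ) ^ (-α) ∧ w 2 k ≤ B₂ * (k : ℝ) ^ (-(2 * α)) := by
  -- The loss α/4 ensures 2β ≥ α and 3β ≥ 2α; the loss (1 - α)/2 ensures 2α - β < 1.
  set β := α - min (α / 4) ((1 - α) / 2) with hβ
  have m1 : min (α / 4) ((1 - α) / 2) ≤ α / 4 := min_le_left _ _
  have m2 : min (α / 4) ((1 - α) / 2) ≤ (1 - α) / 2 := min_le_right _ _
  have m3 : 0 < min (α / 4) ((1 - α) / 2) := lt_min (by linarith) (by linarith)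
  have rate := fun j q hjq => IsMomentSystem.exists_rate_lt (U := U) (β := β) hc hE hα
    (by linarith) (by linarith) (by linarith) hK j q hjq
  have bound := fun q => IsMomentSystem.exists_bound (c := c) (E := E) (U := U) hα hK q
  have hK0 := hK 0
  have hK1 := hK 1
  obtain ⟨D₂, hD₂, hd₂⟩ := rate 2 2 le_rfl
  obtain ⟨D₃, hD₃, hd₃⟩ := rate 3 3 le_rfl
  obtain ⟨U₁, hU₁, hu₁⟩ := bound 1
  obtain ⟨U₂, hU₂, hu₂⟩ := bound 2
  obtain ⟨B₁, hB₁, h₁⟩ := exists_rate_of_recursion (a := α) (r := α) (c := c)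
    (K := c * E * D₂ + K 0 * (1 + U₁) + K 0) (U := U₁) (by linarith) hα' (by linarith) hc
    (by positivity) hU₁.le
  -- The sharp rate of the second moment enters here: k^(-2α) `w 1 k` must be O(k^(-3α)).
  obtain ⟨B₂, hB₂, h₂⟩ := exists_rate_of_recursion (a := α) (r := 2 * α) (c := c)
    (K := c * E * D₃ + K 1 * (B₁ + D₂) + K 1) (U := U₂) (by linarith) hα' (by linarith) hc
    (by positivity) hU₂.le
  refine ⟨B₁, hB₁, B₂, hB₂, fun w hw => ?_⟩
  have d₂ : ∀ k : ℕ, 1 ≤ k → w 2 k ≤ D₂ * (k : ℝ) ^ (-α) := fun k hk =>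
    (hd₂ w hw k hk).trans (mul_le_mul_of_nonneg_left
      (rpow_neg_le_rpow_neg hk (by push_cast; linarith)) hD₂.le)
  have d₃ : ∀ k : ℕ, 1 ≤ k → w 3 k ≤ D₃ * (k : ℝ) ^ (-(2 * α)) := fun k hk =>
    (hd₃ w hw k hk).trans (mul_le_mul_of_nonneg_left
      (rpow_neg_le_rpow_neg hk (by push_cast; linarith)) hD₃.le)
  have r₁ := h₁ (w 1) (hu₁ w hw) (fun k hk => by
    have hkpos : (0 : ℝ) < k := by exact_mod_cast hk
    have hst := hw.step 0 1 k 1 hk le_rfl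
    simp only [zero_add, div_one, one_pow, pow_one, hw.zero k hk, Nat.cast_zero, mul_one] at hst
    have e : (k : ℝ) ^ (-(2 * α)) = (k : ℝ) ^ (-α) * (k : ℝ) ^ (-α) := by
      rw [← Real.rpow_add hkpos]; ring_nf
    have e' : (k : ℝ) ^ (-α - α) = (k : ℝ) ^ (-α) * (k : ℝ) ^ (-α) := by
      rw [← Real.rpow_add hkpos]; ring_nf
    rw [e] at hst
    rw [e']
    set y := (k : ℝ) ^ (-α)
    have hy : 0 ≤ y := by positivity
    have f1 : c * y * (E * w 2 k) ≤ c * y * (E * (D₂ * y)) := by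
      gcongr; exact d₂ k hk
    have f2 : K 0 * (y * y) * (1 + w 1 k) ≤ K 0 * (y * y) * (1 + U₁) := by
      gcongr; exact hu₁ w hw k hk
    norm_num at hst
    nlinarith [f1, f2, hst])
  refine fun k hk => ⟨r₁ k hk, h₂ (w 2) (hu₂ w hw) (fun k hk => ?_) k hk⟩
  have hkpos : (0 : ℝ) < k := by exact_mod_cast hk
  have hst := hw.step 1 1 k 1 hk le_rfl
  simp only [div_one, one_pow, pow_one, Nat.reduceAdd] at hst
  have e : (k : ℝ) ^ (-(2 * α)) = (k : ℝ) ^ (-α) * (k : ℝ) ^ (-α) := by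
    rw [← Real.rpow_add hkpos]; ring_nf
  have e' : (k : ℝ) ^ (-α - 2 * α) = (k : ℝ) ^ (-α) * ((k : ℝ) ^ (-α) * (k : ℝ) ^ (-α)) := by
    rw [← Real.rpow_add hkpos, ← Real.rpow_add hkpos]; ring_nf
  have e3 : (k : ℝ) ^ (-(2 * α * ((1 : ℕ) + 1))) ≤ (k : ℝ) ^ (-α - 2 * α) := by
    rw [show -α - 2 * α = -(3 * α) by ring]
    exact rpow_neg_le_rpow_neg hk (by push_cast; linarith)
  have d3 := d₃ k hk
  rw [e'] at e3 ⊢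
  rw [e] at hst d3
  set y := (k : ℝ) ^ (-α)
  have hy : 0 ≤ y := by positivity
  have f1 : c * y * (E * w 3 k) ≤ c * y * (E * (D₃ * (y * y))) := by
    gcongr
  have f2 : K 1 * (y * y) * (w 1 k + w 2 k) ≤ K 1 * (y * y) * (B₁ * y + D₂ * y) := by
    gcongr
    · exact r₁ k hk
    · exact d₂ k hk
  have f3 := mul_le_mul_of_nonneg_left e3 hK1
  nlinarith [f1, f2, f3, hst]

/-! ### Expansion of even powers of the norm -/

/-- All monomials have degree q + 2, so replacing the smaller of V and Y by the larger one suffices.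
This absorbs the mixed terms in the inductive expansion of ‖x - y‖^(2(q+1)). -/
theorem add_mul_le_interpolation {V Y : ℝ} (hV : 0 ≤ V) (hY : 0 ≤ Y) (q : ℕ) :
    V * Y ^ (q + 1) ≤ V ^ (q + 1) * Y + Y ^ (q + 2) ∧
      V ^ q * Y ^ 2 ≤ V ^ (q + 1) * Y + Y ^ (q + 2) := by
  have p1 : 0 ≤ V ^ (q + 1) * Y := by positivity
  have p2 : 0 ≤ Y ^ (q + 2) := by positivity
  rcases le_total V Y with h | h
  · constructor
    · calc V * Y ^ (q + 1) ≤ Y * Y ^ (q + 1) := by gcongr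
        _ = Y ^ (q + 2) := by ring
        _ ≤ _ := by linarith
    · calc V ^ q * Y ^ 2 ≤ Y ^ q * Y ^ 2 := by gcongr
        _ = Y ^ (q + 2) := by ring
        _ ≤ _ := by linarith
  · constructor
    · calc V * Y ^ (q + 1) = V * Y ^ q * Y := by ring
        _ ≤ V * V ^ q * Y := by gcongr
        _ = V ^ (q + 1) * Y := by ring
        _ ≤ _ := by linarith
    · calc V ^ q * Y ^ 2 = V ^ q * Y * Y := by ring
        _ ≤ V ^ q * V * Y := by gcongr
        _ = V ^ (q + 1) * Y := by ring
        _ ≤ _ := by linarith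

/-- Second-order expansion of `‖x - y‖ ^ (2 (q + 1))`. -/
theorem exists_norm_sub_pow_le (H : Type*) [NormedAddCommGroup H] [InnerProductSpace ℝ H] (q : ℕ) :
    ∃ A : ℝ, 0 ≤ A ∧ ∀ x y : H, (‖x - y‖ ^ 2) ^ (q + 1) ≤
      (‖x‖ ^ 2) ^ (q + 1) - 2 * (q + 1) * (‖x‖ ^ 2) ^ q * ⟪x, y⟫
        + A * ((‖x‖ ^ 2) ^ q * ‖y‖ ^ 2 + (‖y‖ ^ 2) ^ (q + 1)) := by
  induction q with
  | zero =>
    refine ⟨1, zero_le_one, fun x y => ?_⟩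
    have := @norm_sub_sq_real H _ _ x y
    norm_num
    nlinarith [sq_nonneg ‖y‖]
  | succ q ih =>
    obtain ⟨A, hA, h⟩ := ih
    -- The inductive bound is multiplied by ‖x - y‖² ≤ 2(‖x‖² + ‖y‖²). The old error contributes 6A,
    -- the square of the inner product 4(q + 1), the remaining product with the inner product 2(q +
    -- 1), and ‖x‖^(2(q+1)) ‖y‖² the last 1.
    refine ⟨6 * A + 6 * (q + 1) + 1, by positivity, fun x y => ?_⟩
    have hsq := @norm_sub_sq_real H _ _ x y
    have hS : 0 ≤ ‖x - y‖ ^ 2 := by positivity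
    have hpq : ⟪x, y⟫ ^ 2 ≤ ‖x‖ ^ 2 * ‖y‖ ^ 2 := by
      rw [← mul_pow]
      exact sq_le_sq.2 (by
        rw [abs_of_nonneg (by positivity : 0 ≤ ‖x‖ * ‖y‖)]; exact abs_real_inner_le_norm x y)
    have hab := abs_le.1 (abs_real_inner_le_norm x y)
    have hV : 0 ≤ ‖x‖ ^ 2 := by positivity
    have hY : 0 ≤ ‖y‖ ^ 2 := by positivity
    have hp1 : -⟪x, y⟫ ≤ (‖x‖ ^ 2 + ‖y‖ ^ 2) / 2 := by nlinarith [sq_nonneg (‖x‖ - ‖y‖)]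
    have hmul := mul_le_mul_of_nonneg_left (h x y) hS
    rw [← pow_succ'] at hmul
    rw [hsq] at hmul hS ⊢
    obtain ⟨i1, i2⟩ := add_mul_le_interpolation hV hY q
    generalize ‖x‖ ^ 2 = V at *
    generalize ‖y‖ ^ 2 = Y at *
    generalize ⟪x, y⟫ = p at *
    have hVq : 0 ≤ V ^ q := by positivity
    have hSle : V - 2 * p + Y ≤ 2 * (V + Y) := by linarith
    have hAt : (V - 2 * p + Y) * (A * (V ^ q * Y + Y ^ (q + 1)))
        ≤ 2 * (V + Y) * (A * (V ^ q * Y + Y ^ (q + 1))) := by gcongr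
    have hAt2 : 2 * (V + Y) * (A * (V ^ q * Y + Y ^ (q + 1)))
        ≤ 6 * A * (V ^ (q + 1) * Y + Y ^ (q + 2)) := by
      have : (V + Y) * (V ^ q * Y + Y ^ (q + 1))
          = V ^ (q + 1) * Y + V * Y ^ (q + 1) + V ^ q * Y ^ 2 + Y ^ (q + 2) := by ring
      have h3 : (V + Y) * (V ^ q * Y + Y ^ (q + 1)) ≤ 3 * (V ^ (q + 1) * Y + Y ^ (q + 2)) := by
        rw [this]; linarith
      nlinarith [mul_le_mul_of_nonneg_left h3 hA]
    have c0 : (0 : ℝ) ≤ 4 * (q + 1) := by positivity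
    have j1 : 4 * ((q : ℝ) + 1) * V ^ q * p ^ 2 ≤ 4 * (q + 1) * V ^ q * (V * Y) := by gcongr
    have j2 : 2 * ((q : ℝ) + 1) * (Y * V ^ q) * (-p) ≤ 2 * (q + 1) * (Y * V ^ q) * ((V + Y) / 2) := by
      gcongr
    have j3 : ((q : ℝ) + 1) * (V ^ q * Y ^ 2) ≤ (q + 1) * (V ^ (q + 1) * Y + Y ^ (q + 2)) := by
      gcongr
    have hYq : 0 ≤ Y ^ (q + 2) := by positivity
    have k1 : 0 ≤ (5 * ((q : ℝ) + 1) + 1) * Y ^ (q + 2) := by positivity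
    push_cast
    rw [show q + 1 + 1 = q + 2 from rfl] at *
    have e : (V - 2 * p + Y) * (V ^ (q + 1) - 2 * (q + 1) * V ^ q * p
          + A * (V ^ q * Y + Y ^ (q + 1)))
        = V ^ (q + 2) - 2 * (q + 1 + 1) * V ^ (q + 1) * p + V ^ (q + 1) * Y
          + 4 * (q + 1) * V ^ q * p ^ 2 + 2 * (q + 1) * (Y * V ^ q) * (-p)
          + (V - 2 * p + Y) * (A * (V ^ q * Y + Y ^ (q + 1))) := by ring
    rw [e] at hmul
    have e1 : 4 * ((q : ℝ) + 1) * V ^ q * (V * Y) = 4 * (q + 1) * (V ^ (q + 1) * Y) := by ring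
    have e2 : 2 * ((q : ℝ) + 1) * (Y * V ^ q) * ((V + Y) / 2)
        = (q + 1) * (V ^ (q + 1) * Y) + (q + 1) * (V ^ q * Y ^ 2) := by ring
    linarith

/-! ### Spectral lower bound and coercivity of the gradient -/

/-- An operator with a basis of eigenvectors is bounded below by its eigenvalues. -/
theorem HasEigenbasis.le_inner {H : Type*} [NormedAddCommGroup H] [InnerProductSpace ℝ H]
    [CompleteSpace H] {T : H →L[ℝ] H} (hT : HasEigenbasis T) {lam : ℝ}
    (hlam : ∀ l, IsEigenvalue T l → lam ≤ l) (v : H) : lam * ‖v‖ ^ 2 ≤ ⟪T v, v⟫ := by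
  obtain ⟨s, b, hb⟩ := hT
  choose l hl using hb
  have hle : ∀ i, lam ≤ l i := fun i => hlam _ ⟨b i, b.orthonormal.ne_zero i, hl i⟩
  have h1 : HasSum (fun i => lam * (⟪v, b i⟫ * ⟪b i, v⟫)) (lam * ⟪v, v⟫) :=
    (b.hasSum_inner_mul_inner v v).mul_left lam
  have h2 : HasSum (fun i => ⟪v, T (b.repr v i • b i)⟫) ⟪v, T v⟫ :=
    ((b.hasSum_repr v).mapL T).mapL (innerSL ℝ v)
  rw [real_inner_self_eq_norm_sq] at h1
  rw [real_inner_comm]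
  refine hasSum_le (fun i => ?_) h1 h2
  rw [map_smul, hl, inner_smul_right, inner_smul_right, b.repr_apply_apply, real_inner_comm v (b i)]
  nlinarith [mul_le_mul_of_nonneg_right (hle i) (mul_self_nonneg ⟪v, b i⟫)]

theorem lambdaMin_le {H : Type*} [NormedAddCommGroup H] [InnerProductSpace ℝ H]
    (T : H →L[ℝ] H) {l : ℝ} (hl : IsEigenvalue T l) : lambdaMin T ≤ l := by
  -- The eigenvalues are bounded below by -‖T‖, so the real `sInf` is a genuine infimum.
  refine csInf_le ⟨-‖T‖, ?_⟩ hl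
  rintro x ⟨v, hv, hTv⟩
  have hv' : 0 < ‖v‖ := norm_pos_iff.2 hv
  have := T.le_opNorm v
  rw [hTv, norm_smul, mul_le_mul_iff_left₀ hv'] at this
  exact (abs_le.1 this).1

theorem LocallyStronglyConvexAt.lambdaMin_mul_le_inner {H : Type*} [NormedAddCommGroup H]
    [InnerProductSpace ℝ H] [CompleteSpace H] {G : H → ℝ} {m : H}
    (h : LocallyStronglyConvexAt G m) (v : H) :
    lambdaMin (hessian G m) * ‖v‖ ^ 2 ≤ ⟪hessian G m v, v⟫ := by
  obtain ⟨hd, -, ε, hε, hb⟩ := h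
  exact (hb m (Metric.mem_ball_self hε) hd).1.le_inner (fun l hl => lambdaMin_le _ hl) v

theorem hasDerivAt_comp_line {H : Type*} [NormedAddCommGroup H] [InnerProductSpace ℝ H]
    [CompleteSpace H] {G : H → ℝ} (hd : Differentiable ℝ G) (x v : H) (t : ℝ) :
    HasDerivAt (fun s : ℝ => G (x + s • v)) ⟪gradient G (x + t • v), v⟫ t := by
  have h1 : HasDerivAt (fun s : ℝ => x + s • v) v t := by
    simpa using ((hasDerivAt_id t).smul_const v).const_add x
  have h2 := (hd (x + t • v)).hasGradientAt.hasFDerivAt.comp_hasDerivAt t h1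
  rw [InnerProductSpace.toDual_apply_apply] at h2
  exact h2

theorem ConvexOn.inner_gradient_le {H : Type*} [NormedAddCommGroup H]
    [InnerProductSpace ℝ H] [CompleteSpace H] {G : H → ℝ} (hG : ConvexOn ℝ Set.univ G)
    (hd : Differentiable ℝ G) (x y : H) : ⟪gradient G x, y - x⟫ ≤ G y - G x := by
  have hline : HasDerivAt (fun t : ℝ => G (x + t • (y - x))) ⟪gradient G x, y - x⟫ 0 := by
    simpa only [zero_smul, add_zero] using hasDerivAt_comp_line hd x (y - x) 0
  have hconv : ConvexOn ℝ Set.univ (fun t : ℝ => G (x + t • (y - x))) := by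
    have := hG.comp_affineMap (AffineMap.lineMap x y : ℝ →ᵃ[ℝ] H)
    rw [Set.preimage_univ] at this
    refine this.congr fun t _ => ?_
    simp [AffineMap.lineMap_apply, add_comm]
  have := hconv.le_slope_of_hasDerivAt (Set.mem_univ 0) (Set.mem_univ 1) one_pos hline
  simpa [slope_def_field] using this

theorem ConvexOn.gradient_monotone {H : Type*} [NormedAddCommGroup H]
    [InnerProductSpace ℝ H] [CompleteSpace H] {G : H → ℝ} (hG : ConvexOn ℝ Set.univ G)
    (hd : Differentiable ℝ G) (x y : H) : 0 ≤ ⟪gradient G x - gradient G y, x - y⟫ := by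
  have h1 := hG.inner_gradient_le hd x y
  have h2 := hG.inner_gradient_le hd y x
  rw [← neg_sub x y, inner_neg_right] at h1
  rw [inner_sub_left]
  linarith

/-- Coercivity of the gradient of a convex function that has a positive Hessian at a minimiser,
at any truncation level `M`. -/
theorem exists_coercive_gradient {H : Type*} [NormedAddCommGroup H]
    [InnerProductSpace ℝ H] [CompleteSpace H] {G : H → ℝ} (hG : ConvexOn ℝ Set.univ G)
    (hd : Differentiable ℝ G) {m : H} {T : H →L[ℝ] H} {lam Cm : ℝ} (hlam : 0 < lam)
    (hCm : 0 < Cm) (hT : ∀ v, lam * ‖v‖ ^ 2 ≤ ⟪T v, v⟫)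
    (h3 : ∀ h, ‖gradient G h - T (h - m)‖ ≤ Cm * ‖h - m‖ ^ 2) (hm : gradient G m = 0) :
    ∃ E : ℝ, 0 < E ∧ ∀ (h : H) (M : ℝ) (s : ℕ), 1 ≤ M →
      lam / 2 / M * (‖h - m‖ ^ 2 - (E / M ^ 2) ^ s * (‖h - m‖ ^ 2) ^ (1 + s))
        ≤ ⟪h - m, gradient G h⟫ := by
  -- Within this radius the quadratic error of (H3) costs at most half of the spectral lower bound.
  set ε := lam / (2 * Cm) with hε
  have hε0 : 0 < ε := by positivity
  have near : ∀ h : H, ‖h - m‖ ≤ ε → lam / 2 * ‖h - m‖ ^ 2 ≤ ⟪h - m, gradient G h⟫ := by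
    intro h hh
    have e : gradient G h = T (h - m) + (gradient G h - T (h - m)) := by abel
    rw [e, inner_add_right, real_inner_comm]
    have h1 := hT (h - m)
    have h2 := (abs_le.1 (abs_real_inner_le_norm (h - m) (gradient G h - T (h - m)))).1
    have h4 : ‖h - m‖ * ‖gradient G h - T (h - m)‖ ≤ ‖h - m‖ * (Cm * ‖h - m‖ ^ 2) := by
      gcongr; exact h3 h
    have h5 : ‖h - m‖ * (Cm * ‖h - m‖ ^ 2) ≤ ε * (Cm * ‖h - m‖ ^ 2) := by gcongr
    have h6 : ε * (Cm * ‖h - m‖ ^ 2) = lam / 2 * ‖h - m‖ ^ 2 := by rw [hε]; field_simp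
    linarith
  -- Monotonicity of the gradient transports the estimate from the point y of the segment [m, h] at
  -- distance ε from m, which leaves linear growth.
  have far : ∀ h : H, ε ≤ ‖h - m‖ → lam / 2 * ε * ‖h - m‖ ≤ ⟪h - m, gradient G h⟫ := by
    intro h hh
    have hpos : 0 < ‖h - m‖ := hε0.trans_le hh
    set t := ε / ‖h - m‖ with ht
    have ht0 : 0 < t := by positivity
    have ht1 : t ≤ 1 := (div_le_one hpos).2 hh
    set y := m + t • (h - m) with hy
    have hym : y - m = t • (h - m) := by rw [hy]; abel
    have hnorm : ‖y - m‖ = ε := by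
      rw [hym, norm_smul, Real.norm_of_nonneg ht0.le, ht]; field_simp
    have h1 := near y hnorm.le
    have h2 := hG.gradient_monotone hd h y
    have hhy : h - y = (1 - t) • (h - m) := by rw [hy, sub_smul, one_smul]; abel
    rw [hhy, inner_smul_right, inner_sub_left, real_inner_comm, real_inner_comm _ (gradient G y)]
      at h2
    rw [hym, inner_smul_left, ← hym, hnorm] at h1
    simp only [conj_trivial] at h1
    have h5 : lam / 2 * ε * ‖h - m‖ ≤ ⟪h - m, gradient G y⟫ := by
      have : t * (lam / 2 * ε * ‖h - m‖) = lam / 2 * ε ^ 2 := by rw [ht]; field_simp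
      exact le_of_mul_le_mul_left (by rw [this]; exact h1) ht0
    -- Monotonicity says nothing when t = 1, but then y = h.
    rcases ht1.lt_or_eq with hlt | heq
    · have h6 : 0 ≤ ⟪h - m, gradient G h⟫ - ⟪h - m, gradient G y⟫ :=
        nonneg_of_mul_nonneg_right h2 (by linarith)
      linarith
    · have : y = h := by rw [hy, heq, one_smul]; abel
      rwa [this] at h5
  have nonneg : ∀ h : H, 0 ≤ ⟪h - m, gradient G h⟫ := fun h => by
    have := hG.gradient_monotone hd h m
    rwa [hm, sub_zero, real_inner_comm] at this
  refine ⟨1 / ε ^ 2, by positivity, fun h M s hM => ?_⟩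
  have hM0 : 0 < M := by linarith
  have hp : 0 ≤ (1 / ε ^ 2 / M ^ 2) ^ s * (‖h - m‖ ^ 2) ^ (1 + s) := by positivity
  -- Up to radius εM, linear growth dominates (λ/2M)‖h - m‖². Beyond it, E = ε⁻² makes the bracket
  -- nonpositive, and the inner product is nonnegative.
  rcases le_total ‖h - m‖ (ε * M) with hle | hle
  · have : lam / 2 / M * ‖h - m‖ ^ 2 ≤ ⟪h - m, gradient G h⟫ := by
      rcases le_total ‖h - m‖ ε with h1 | h1
      · refine le_trans ?_ (near h h1)
        exact mul_le_mul_of_nonneg_right (div_le_self (by positivity) hM) (by positivity)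
      · refine le_trans ?_ (far h h1)
        rw [div_mul_eq_mul_div, div_le_iff₀ hM0]
        nlinarith [mul_le_mul_of_nonneg_left hle (by positivity : 0 ≤ lam / 2 * ‖h - m‖)]
    refine le_trans ?_ this
    gcongr
    linarith
  · refine le_trans ?_ (nonneg h)
    apply mul_nonpos_of_nonneg_of_nonpos (by positivity)
    have h1 : 1 ≤ 1 / ε ^ 2 / M ^ 2 * ‖h - m‖ ^ 2 := by
      rw [div_div, div_mul_eq_mul_div, one_mul, le_div_iff₀ (by positivity), one_mul, ← mul_pow]
      gcongr
    have h2 := one_le_pow₀ h1 (n := s)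
    have e : (1 / ε ^ 2 / M ^ 2) ^ s * (‖h - m‖ ^ 2) ^ (1 + s)
        = ‖h - m‖ ^ 2 * (1 / ε ^ 2 / M ^ 2 * ‖h - m‖ ^ 2) ^ s := by
      rw [mul_pow]; ring
    rw [e]
    nlinarith [sq_nonneg ‖h - m‖]

/-! ### Differentiation under the expectation -/

/-- Convergence of integrals under almost everywhere convergence and boundedness in `L²`. -/
theorem tendsto_integral_of_ae_tendsto_of_eLpNorm_two_le {X : Type*} [MeasurableSpace X]
    {μ : Measure X} [IsFiniteMeasure μ] {f : ℕ → X → ℝ} {F : X → ℝ}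
    (hf : ∀ n, AEStronglyMeasurable (f n) μ) (hF : Integrable F μ) (C : NNReal)
    (hC : ∀ n, eLpNorm (f n) 2 μ ≤ C)
    (hlim : ∀ᵐ x ∂μ, Tendsto (fun n => f n x) atTop (𝓝 (F x))) :
    Tendsto (fun n => ∫ x, f n x ∂μ) atTop (𝓝 (∫ x, F x ∂μ)) := by
  have hui : UnifIntegrable f 1 μ := by
    intro ε hε
    -- By Cauchy–Schwarz the L¹ norm on s is at most C μ(s)^(1/2); C + 1 avoids a division by zero.
    refine ⟨(ε / (C + 1)) ^ 2, by positivity, fun n s hs hμs => ?_⟩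
    rw [eLpNorm_indicator_eq_eLpNorm_restrict hs]
    have h1 := eLpNorm_le_eLpNorm_mul_rpow_measure_univ (μ := μ.restrict s) (p := 1) (q := 2)
      (by norm_num) (hf n).restrict
    refine h1.trans ?_
    rw [Measure.restrict_apply_univ]
    have h2 : eLpNorm (f n) 2 (μ.restrict s) ≤ ENNReal.ofReal (C + 1) :=
      (eLpNorm_mono_measure _ Measure.restrict_le_self).trans ((hC n).trans (by
        rw [ENNReal.le_ofReal_iff_toReal_le ENNReal.coe_ne_top (by positivity)]
        simp))
    have h3 : μ s ^ (1 / (1 : ENNReal).toReal - 1 / (2 : ENNReal).toReal)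
        ≤ ENNReal.ofReal (ε / (C + 1)) := by
      calc _ ≤ ENNReal.ofReal ((ε / (C + 1)) ^ 2)
            ^ (1 / (1 : ENNReal).toReal - 1 / (2 : ENNReal).toReal) := by
            gcongr; norm_num
        _ = _ := by
            rw [ENNReal.ofReal_rpow_of_nonneg (by positivity) (by norm_num),
              ← Real.rpow_natCast, ← Real.rpow_mul (by positivity)]
            norm_num
    calc _ ≤ ENNReal.ofReal (C + 1) * ENNReal.ofReal (ε / (C + 1)) := by gcongr
      _ = ENNReal.ofReal ε := by
        rw [← ENNReal.ofReal_mul (by positivity)]; congr 1; field_simp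
  refine tendsto_integral_of_L1' _ hF.1 (.of_forall fun n => ?_)
    (tendsto_Lp_finite_of_tendsto_ae le_rfl ENNReal.one_ne_top hf
      (memLp_one_iff_integrable.2 hF) hui hlim)
  exact MemLp.integrable (q := 2) (by norm_num) ⟨hf n, (hC n).trans_lt ENNReal.coe_lt_top⟩

/-- The increment of a differentiable function is bounded by the integral of its derivative. -/
theorem enorm_sub_le_lintegral_of_hasDerivAt {f f' : ℝ → ℝ} (hf : ∀ t, HasDerivAt f (f' t) t)
    (hm : Measurable f') {t : ℝ} (ht : 0 ≤ t) :
    ‖f t - f 0‖ₑ ≤ ∫⁻ s in Set.Ioc 0 t, ‖f' s‖ₑ := by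
  by_cases hfin : ∫⁻ s in Set.Ioc 0 t, ‖f' s‖ₑ = ⊤
  · rw [hfin]; exact le_top
  have hint : IntegrableOn f' (Set.Ioc 0 t) :=
    ⟨hm.aestronglyMeasurable, lt_top_iff_ne_top.2 hfin⟩
  rw [← intervalIntegral.integral_eq_sub_of_hasDerivAt (fun s _ => hf s)
    ((intervalIntegrable_iff_integrableOn_Ioc_of_le ht).2 hint),
    intervalIntegral.integral_of_le ht]
  exact enorm_integral_le_lintegral_enorm _

theorem sq_lintegral_Ioc_le {f : ℝ → ENNReal} (hf : Measurable f) (t : ℝ) :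
    (∫⁻ s in Set.Ioc 0 t, f s) ^ 2 ≤ ENNReal.ofReal t * ∫⁻ s in Set.Ioc 0 t, f s ^ 2 := by
  have h := ENNReal.lintegral_mul_le_Lp_mul_Lq (volume.restrict (Set.Ioc 0 t))
    (Real.holderConjugate_iff.2 ⟨by norm_num, by norm_num⟩ : Real.HolderConjugate 2 2)
    (f := f) (g := fun _ => 1) hf.aemeasurable aemeasurable_const
  simp only [Pi.mul_apply, mul_one, ENNReal.one_rpow, lintegral_const, one_mul,
    Measure.restrict_apply_univ, Real.volume_Ioc, sub_zero] at h
  calc _ ≤ ((∫⁻ s in Set.Ioc 0 t, f s ^ (2 : ℝ)) ^ (1 / 2 : ℝ) *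
        ENNReal.ofReal t ^ (1 / 2 : ℝ)) ^ 2 := by gcongr
    _ = _ := by
      rw [mul_pow, ← ENNReal.rpow_natCast, ← ENNReal.rpow_mul, ← ENNReal.rpow_natCast,
        ← ENNReal.rpow_mul, mul_comm]
      norm_num

section Interchange

variable {H : Type*} [NormedAddCommGroup H] [InnerProductSpace ℝ H] [CompleteSpace H]
  [MeasurableSpace H] {𝒳 : Type*} [MeasurableSpace 𝒳] {μ : Measure 𝒳} {g : 𝒳 → H → ℝ}

theorem measurable_gradient_left (hg_meas : Measurable (fun z : 𝒳 × H => gradient (g z.1) z.2))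
    (h : H) : Measurable (fun x => gradient (g x) h) :=
  hg_meas.comp (measurable_id.prodMk measurable_const)

variable [SecondCountableTopology H] [BorelSpace H]

theorem memLp_two_gradient (hg_meas : Measurable (fun z : 𝒳 × H => gradient (g z.1) z.2)) {h : H}
    (hint : Integrable (fun x => ‖gradient (g x) h‖ ^ 2) μ) :
    MemLp (fun x => gradient (g x) h) 2 μ :=
  (memLp_two_iff_integrable_sq_norm
    (measurable_gradient_left hg_meas h).aestronglyMeasurable).2 hint

variable [IsProbabilityMeasure μ]

/-- Increments of `g x` are bounded in `L²` by the length of the segment. -/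
theorem lintegral_sq_increment_le
    (hg_diff : ∀ᵐ x ∂μ, Differentiable ℝ (g x))
    (hg_meas : Measurable (fun z : 𝒳 × H => gradient (g z.1) z.2)) {L : ℝ} (hL : 0 ≤ L) {m : H}
    (hint : ∀ h : H, Integrable (fun x => ‖gradient (g x) h‖ ^ 2) μ ∧
      ∫ x, ‖gradient (g x) h‖ ^ 2 ∂μ ≤ L * (1 + ‖h - m‖ ^ 2)) (h v : H) {t : ℝ} (ht : 0 ≤ t)
    (ht1 : t ≤ 1) :
    ∫⁻ x, ‖g x (h + t • v) - g x h‖ₑ ^ 2 ∂μ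
      ≤ ENNReal.ofReal (t ^ 2 * (‖v‖ ^ 2 * (L * (1 + (‖h - m‖ + ‖v‖) ^ 2)))) := by
  set D := ‖v‖ ^ 2 * (L * (1 + (‖h - m‖ + ‖v‖) ^ 2)) with hD
  have hφ : Measurable (fun z : 𝒳 × ℝ => ⟪gradient (g z.1) (h + z.2 • v), v⟫) := by
    have : Measurable (fun z : 𝒳 × ℝ => gradient (g z.1) (h + z.2 • v)) :=
      hg_meas.comp (measurable_fst.prodMk (by fun_prop))
    exact this.inner measurable_const
  have hφx : ∀ x, Measurable (fun s : ℝ => ⟪gradient (g x) (h + s • v), v⟫) := fun x =>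
    hφ.comp (measurable_const.prodMk measurable_id)
  have h1 : ∀ᵐ x ∂μ, ‖g x (h + t • v) - g x h‖ₑ ^ 2 ≤
      ENNReal.ofReal t * ∫⁻ s in Set.Ioc 0 t, ‖⟪gradient (g x) (h + s • v), v⟫‖ₑ ^ 2 := by
    filter_upwards [hg_diff] with x hx
    refine le_trans ?_ (sq_lintegral_Ioc_le (hφx x).enorm t)
    gcongr
    simpa using enorm_sub_le_lintegral_of_hasDerivAt (hasDerivAt_comp_line hx h v) (hφx x) ht
  have h2 : ∀ s ∈ Set.Ioc 0 t,
      ∫⁻ x, ‖⟪gradient (g x) (h + s • v), v⟫‖ₑ ^ 2 ∂μ ≤ ENNReal.ofReal D := by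
    intro s hs
    obtain ⟨i1, i2⟩ := hint (h + s • v)
    calc _ ≤ ∫⁻ x, ENNReal.ofReal (‖v‖ ^ 2 * ‖gradient (g x) (h + s • v)‖ ^ 2) ∂μ := by
          refine lintegral_mono fun x => ?_
          rw [← ofReal_norm, ← ENNReal.ofReal_pow (norm_nonneg _), ← mul_pow]
          refine ENNReal.ofReal_le_ofReal ?_
          gcongr
          rw [mul_comm]
          exact norm_inner_le_norm _ _
      _ = ENNReal.ofReal (‖v‖ ^ 2 * ∫ x, ‖gradient (g x) (h + s • v)‖ ^ 2 ∂μ) := by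
          rw [← integral_const_mul, ofReal_integral_eq_lintegral_ofReal (i1.const_mul _)
            (.of_forall fun x => by positivity)]
      _ ≤ _ := by
          refine ENNReal.ofReal_le_ofReal ?_
          rw [hD]
          gcongr
          refine i2.trans ?_
          gcongr
          calc ‖h + s • v - m‖ = ‖(h - m) + s • v‖ := by congr 1; abel
            _ ≤ ‖h - m‖ + ‖s • v‖ := norm_add_le _ _
            _ ≤ _ := by
              rw [norm_smul, Real.norm_of_nonneg hs.1.le]
              have := hs.2
              have := mul_le_mul_of_nonneg_right (by linarith : s ≤ 1) (norm_nonneg v)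
              linarith
  calc _ ≤ ∫⁻ x, (ENNReal.ofReal t *
        ∫⁻ s in Set.Ioc 0 t, ‖⟪gradient (g x) (h + s • v), v⟫‖ₑ ^ 2) ∂μ := lintegral_mono_ae h1
    _ = ENNReal.ofReal t *
        ∫⁻ s in Set.Ioc 0 t, (∫⁻ x, ‖⟪gradient (g x) (h + s • v), v⟫‖ₑ ^ 2 ∂μ) := by
        rw [lintegral_const_mul' _ _ ENNReal.ofReal_ne_top, lintegral_lintegral_swap]
        exact (hφ.enorm.pow_const 2).aemeasurable
    _ ≤ ENNReal.ofReal t * ∫⁻ _ in Set.Ioc 0 t, ENNReal.ofReal D := by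
        refine mul_le_mul_right ?_ _
        exact setLIntegral_mono measurable_const h2
    _ = _ := by
        rw [setLIntegral_const, Real.volume_Ioc, sub_zero, ← ENNReal.ofReal_mul (by positivity),
          ← ENNReal.ofReal_mul ht]
        congr 1; ring

/-- Under a bound on the second moment of `∇g`, the gradient of `G = E[g(X, ·)]` is `E[∇g(X, ·)]`. -/
theorem gradient_objective_eq_integral
    (hg_int : ∀ h, Integrable (fun x => g x h) μ)
    (hg_diff : ∀ᵐ x ∂μ, Differentiable ℝ (g x))
    (hg_meas : Measurable (fun z : 𝒳 × H => gradient (g z.1) z.2))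
    (hG : Differentiable ℝ (objective μ g)) {L : ℝ} (hL : 0 ≤ L) {m : H}
    (hint : ∀ h : H, Integrable (fun x => ‖gradient (g x) h‖ ^ 2) μ ∧
      ∫ x, ‖gradient (g x) h‖ ^ 2 ∂μ ≤ L * (1 + ‖h - m‖ ^ 2)) (h : H) :
    gradient (objective μ g) h = ∫ x, gradient (g x) h ∂μ := by
  have hgi : Integrable (fun x => gradient (g x) h) μ :=
    (memLp_two_gradient hg_meas (hint h).1).integrable (by norm_num)
  refine ext_inner_right ℝ fun v => ?_
  have e : ⟪∫ x, gradient (g x) h ∂μ, v⟫ = ∫ x, ⟪gradient (g x) h, v⟫ ∂μ := by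
    rw [real_inner_comm, ← integral_inner hgi]
    exact integral_congr_ae (.of_forall fun x => real_inner_comm _ _)
  rw [e]
  set D := ‖v‖ ^ 2 * (L * (1 + (‖h - m‖ + ‖v‖) ^ 2)) with hD
  have hD0 : 0 ≤ D := by positivity
  set t : ℕ → ℝ := fun n => 1 / ((n : ℝ) + 1) with ht
  have ht0 : ∀ n, 0 < t n := fun n => by positivity
  have ht1 : ∀ n, t n ≤ 1 := fun n => by
    rw [ht]; simp only
    rw [div_le_one (by positivity)]
    linarith [(Nat.cast_nonneg n : (0 : ℝ) ≤ n)]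
  have htlim : Tendsto t atTop (𝓝[≠] 0) :=
    tendsto_nhdsWithin_iff.2 ⟨tendsto_one_div_add_atTop_nhds_zero_nat,
      .of_forall fun n => (ht0 n).ne'⟩
  have quot : ∀ {F : H → ℝ}, Differentiable ℝ F →
      Tendsto (fun n => (t n)⁻¹ * (F (h + t n • v) - F h)) atTop (𝓝 ⟪gradient F h, v⟫) := by
    intro F hF
    have h1 := (hasDerivAt_comp_line hF h v 0).tendsto_slope_zero.comp htlim
    simpa [Function.comp_def] using h1
  have lim1 := quot hG
  -- The difference quotients have L² norm at most √D, uniformly along t → 0, so Vitali's theorem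
  -- identifies the limit of their integrals without a pointwise dominating function.
  have lim2 := tendsto_integral_of_ae_tendsto_of_eLpNorm_two_le (μ := μ)
    (f := fun n x => (t n)⁻¹ * (g x (h + t n • v) - g x h))
    (F := fun x => ⟪gradient (g x) h, v⟫)
    (fun n => (((hg_int _).sub (hg_int _)).const_mul _).aestronglyMeasurable)
    (hgi.inner_const v) (NNReal.sqrt D.toNNReal) (fun n => ?_)
    (by filter_upwards [hg_diff] with x hx using quot hx)
  · refine tendsto_nhds_unique lim1 (lim2.congr fun n => ?_)
    rw [integral_const_mul, integral_sub (hg_int _) (hg_int _)]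
    rfl
  · have h1 := lintegral_sq_increment_le hg_diff hg_meas hL hint h v (ht0 n).le (ht1 n)
    have h2 : ∫⁻ x, ‖(t n)⁻¹ * (g x (h + t n • v) - g x h)‖ₑ ^ 2 ∂μ ≤ ENNReal.ofReal D := by
      simp_rw [enorm_mul, mul_pow]
      rw [lintegral_const_mul' _ _ (by simp)]
      calc _ ≤ ‖(t n)⁻¹‖ₑ ^ 2 * ENNReal.ofReal (t n ^ 2 * D) := by gcongr
        _ = _ := by
          rw [← ofReal_norm, ← ENNReal.ofReal_pow (norm_nonneg _),
            ← ENNReal.ofReal_mul (by positivity)]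
          congr 1
          have := (ht0 n).ne'
          rw [Real.norm_of_nonneg (by have := ht0 n; positivity)]
          field_simp
    rw [eLpNorm_eq_lintegral_rpow_enorm_toReal (by norm_num) (by norm_num)]
    simp only [ENNReal.toReal_ofNat, ENNReal.rpow_ofNat]
    calc _ ≤ ENNReal.ofReal D ^ (1 / 2 : ℝ) := by gcongr
      _ = _ := by
        rw [ENNReal.ofReal_rpow_of_nonneg hD0 (by norm_num), ← Real.sqrt_eq_rpow,
          ENNReal.ofReal, Real.sqrt, Real.toNNReal_coe]
end Interchange

/-! ### Independence of a data item from the iterates -/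

section Independence

/-- If `Z` is independent of `(X, Y)`, and `X` of `Y`, then `X` is independent of `(Y, Z)`. -/
theorem indepFun_prodMk_right_of_indepFun {Ω A B C : Type*} [MeasurableSpace Ω] [MeasurableSpace A]
    [MeasurableSpace B] [MeasurableSpace C] {P : Measure Ω} [IsProbabilityMeasure P] {X : Ω → A}
    {Y : Ω → B} {Z : Ω → C} (hX : Measurable X) (hY : Measurable Y) (hZ : Measurable Z)
    (hXY : IndepFun X Y P) (h : IndepFun Z (fun ω => (X ω, Y ω)) P) :
    IndepFun X (fun ω => (Y ω, Z ω)) P := by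
  have := Measure.isProbabilityMeasure_map (μ := P) hX.aemeasurable
  have := Measure.isProbabilityMeasure_map (μ := P) hY.aemeasurable
  have := Measure.isProbabilityMeasure_map (μ := P) hZ.aemeasurable
  have hYZ : IndepFun Y Z P := (h.comp measurable_id measurable_snd).symm
  rw [indepFun_iff_map_prod_eq_prod_map_map hX.aemeasurable (hY.prodMk hZ).aemeasurable,
    (indepFun_iff_map_prod_eq_prod_map_map hY.aemeasurable hZ.aemeasurable).1 hYZ]
  have h1 := (indepFun_iff_map_prod_eq_prod_map_map (hX.prodMk hY).aemeasurable
    hZ.aemeasurable).1 h.symm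
  rw [(indepFun_iff_map_prod_eq_prod_map_map hX.aemeasurable hY.aemeasurable).1 hXY] at h1
  rw [← Measure.prodAssoc_prod, ← h1,
    Measure.map_map MeasurableEquiv.prodAssoc.measurable ((hX.prodMk hY).prodMk hZ)]
  rfl

variable {Ω 𝒳 H : Type*} [MeasurableSpace Ω] [MeasurableSpace 𝒳] [NormedAddCommGroup H]
  [MeasurableSpace H] {P : Measure Ω} [IsProbabilityMeasure P] {μ : Measure 𝒳} {R : ℝ} {p : ℕ}
  {X : Fin p → ℕ → Ω → 𝒳} {m₁ : Fin p → Ω → H}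

/-- The data with the exception of one item `X_{i, k + 2}`, `q = (i, k)`, and the starting
points. -/
def otherData (X : Fin p → ℕ → Ω → 𝒳) (m₁ : Fin p → Ω → H) (q : Fin p × ℕ) (ω : Ω) :
    ({r : Fin p × ℕ // r ≠ q} → 𝒳) × (Fin p → H) :=
  (fun r => X r.1.1 (r.1.2 + 2) ω, fun i => m₁ i ω)

/-- The joint independence of the data isolates one item from the other items, and the independence
of the starting points from all items adds these. Every iterate that precedes the use of the item,
and every iterate of another machine, is a function of `otherData`. -/
theorem IsMachineData.indepFun_otherData (h : IsMachineData P μ R X m₁) (q : Fin p × ℕ) :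
    IndepFun (X q.1 (q.2 + 2)) (otherData X m₁ q) P := by
  have hm : ∀ r : Fin p × ℕ, Measurable (X r.1 (r.2 + 2)) :=
    fun r => h.measurable_data _ _ (by omega)
  have hi : iIndepFun (fun r : Fin p × ℕ => X r.1 (r.2 + 2)) P :=
    h.indep_data.precomp (g := fun r : Fin p × ℕ => (r.1, r.2 + 1)) (fun a b hab => by
      simp only [Prod.mk.injEq, add_left_inj] at hab
      exact Prod.ext hab.1 hab.2)
  refine indepFun_prodMk_right_of_indepFun (hm q) (measurable_pi_lambda _ fun r => hm r.1)
    (measurable_pi_lambda _ fun i => h.measurable_start i) ?_ ?_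
  · have h1 := indep_iSup_of_disjoint (fun r => (hm r).comap_le) hi.iIndep
      (S := {q}) (T := {q}ᶜ) disjoint_compl_right
    rw [IndepFun_iff_Indep]
    refine indep_of_indep_of_le h1 (by simp) ?_
    rw [MeasurableSpace.pi, MeasurableSpace.comap_iSup]
    refine iSup_le fun r => ?_
    rw [MeasurableSpace.comap_comp]
    exact le_iSup₂_of_le r.1 r.2 le_rfl
  · exact h.indep_start.comp measurable_id
      ((measurable_pi_apply q).prodMk (measurable_pi_lambda _ fun r : {r // r ≠ q} => measurable_pi_apply r.1))

end Independence

/-- Measurability is required only of the items already used, and the σ-algebra on `Ω` is arbitrary: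
the lemma is also applied to the σ-algebra generated by `otherData`, where it expresses that the
iterate does not depend on the omitted item. -/
theorem measurable_sgd {Ω 𝒳 H : Type*} [MeasurableSpace Ω] [MeasurableSpace 𝒳]
    [NormedAddCommGroup H] [InnerProductSpace ℝ H] [CompleteSpace H] [SecondCountableTopology H]
    [MeasurableSpace H] [BorelSpace H] {g : 𝒳 → H → ℝ} {cγ α : ℝ}
    (hg : Measurable (fun z : 𝒳 × H => gradient (g z.1) z.2)) {m₁ : Ω → H} {X : ℕ → Ω → 𝒳}
    (hm : Measurable m₁) (k : ℕ) (hX : ∀ l < k, Measurable (X (l + 2))) :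
    Measurable (fun ω => sgd g cγ α (m₁ ω) (fun l => X l ω) (k + 1)) := by
  induction k with
  | zero => exact hm
  | succ k ih =>
    have ih := ih fun l hl => hX l (by omega)
    exact ih.sub ((hg.comp ((hX k (by omega)).prodMk ih)).const_smul (stepSize cγ α (k + 1)))

theorem IsMachineData.indepFun_sgd {Ω 𝒳 H : Type*} [MeasurableSpace Ω] [MeasurableSpace 𝒳]
    [NormedAddCommGroup H] [InnerProductSpace ℝ H] [CompleteSpace H] [SecondCountableTopology H]
    [MeasurableSpace H] [BorelSpace H] {P : Measure Ω} [IsProbabilityMeasure P] {μ : Measure 𝒳}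
    {R : ℝ} {p : ℕ} {X : Fin p → ℕ → Ω → 𝒳} {m₁ : Fin p → Ω → H} {g : 𝒳 → H → ℝ} {cγ α : ℝ}
    (h : IsMachineData P μ R X m₁)
    (hg : Measurable (fun z : 𝒳 × H => gradient (g z.1) z.2)) (i : Fin p) (k : ℕ) :
    IndepFun (X i (k + 2)) (fun ω => sgd g cγ α (m₁ i ω) (fun l => X i l ω) (k + 1)) P := by
  have h1 := h.indepFun_otherData (i, k)
  rw [IndepFun_iff_Indep] at h1 ⊢
  refine indep_of_indep_of_le_right h1 (Measurable.comap_le ?_)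
  have hc := comap_measurable (m := inferInstance) (otherData X m₁ (i, k))
  -- From here on, measurability on `Ω` refers to the σ-algebra generated by the other data.
  let _ : MeasurableSpace Ω := MeasurableSpace.comap (otherData X m₁ (i, k)) inferInstance
  exact measurable_sgd hg ((measurable_pi_apply i).comp (measurable_snd.comp hc)) k fun l hl =>
    (measurable_pi_apply (⟨(i, l), by simp; omega⟩ : {r : Fin p × ℕ // r ≠ (i, k)})).comp
      (measurable_fst.comp hc)

/-- The data item used by machine `j` at a step is independent of the pair formed by its current
iterate and by the iterate and the data item of another step, made by another machine or earlier. -/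
theorem IsMachineData.indepFun_sgd_prod {Ω 𝒳 H : Type*} [MeasurableSpace Ω] [MeasurableSpace 𝒳]
    [NormedAddCommGroup H] [InnerProductSpace ℝ H] [CompleteSpace H] [SecondCountableTopology H]
    [MeasurableSpace H] [BorelSpace H] {P : Measure Ω} [IsProbabilityMeasure P] {μ : Measure 𝒳}
    {R : ℝ} {p : ℕ} {X : Fin p → ℕ → Ω → 𝒳} {m₁ : Fin p → Ω → H} {g : 𝒳 → H → ℝ} {cγ α : ℝ}
    (h : IsMachineData P μ R X m₁)
    (hg : Measurable (fun z : 𝒳 × H => gradient (g z.1) z.2)) {i j : Fin p} {k l : ℕ}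
    (hne : i ≠ j ∨ k < l) :
    IndepFun (X j (l + 2)) (fun ω => (sgd g cγ α (m₁ j ω) (fun l => X j l ω) (l + 1),
      X i (k + 2) ω, sgd g cγ α (m₁ i ω) (fun l => X i l ω) (k + 1))) P := by
  have h1 := h.indepFun_otherData (j, l)
  rw [IndepFun_iff_Indep] at h1 ⊢
  refine indep_of_indep_of_le_right h1 (Measurable.comap_le ?_)
  have hc := comap_measurable (m := inferInstance) (otherData X m₁ (j, l))
  let _ : MeasurableSpace Ω := MeasurableSpace.comap (otherData X m₁ (j, l)) inferInstance
  have hX : ∀ i k, (i, k) ≠ (j, l) → Measurable (X i (k + 2)) := fun i k hik =>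
    (measurable_pi_apply (⟨(i, k), hik⟩ : {r : Fin p × ℕ // r ≠ (j, l)})).comp
      (measurable_fst.comp hc)
  have hm : ∀ i, Measurable (m₁ i) := fun i =>
    (measurable_pi_apply i).comp (measurable_snd.comp hc)
  have hik : ∀ k' ≤ k, (i, k') ≠ (j, l) := by
    rintro k' hk' heq
    simp only [Prod.mk.injEq] at heq
    rcases hne with h2 | h2
    · exact h2 heq.1
    · omega
  exact (measurable_sgd hg (hm j) l fun l' hl' => hX _ _ (by simp; omega)).prodMk
    ((hX i k (hik k le_rfl)).prodMk
      (measurable_sgd hg (hm i) k fun k' hk' => hX _ _ (hik k' hk'.le)))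

/-! ### Integrating out an independent data item -/

section Fubini

variable {Ω 𝒳 Y : Type*} [MeasurableSpace Ω] [MeasurableSpace 𝒳] [MeasurableSpace Y]
  {P : Measure Ω} [IsProbabilityMeasure P] {X : Ω → 𝒳} {T : Ω → Y}

/-- Under independence the joint law is a product, so Fubini's theorem plays the role of conditional
expectation. Integrability is a conclusion: the section integrals are dominated by ψ. -/
theorem IndepFun.integral_le_of_integral_le (hX : Measurable X) (hT : Measurable T)
    (hXT : IndepFun X T P) {f : 𝒳 × Y → ℝ} (hf : Measurable f) (hf0 : ∀ z, 0 ≤ f z) {ψ : Y → ℝ}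
    (hψ : Integrable (fun ω => ψ (T ω)) P)
    (hψm : Measurable ψ)
    (hint : ∀ y, Integrable (fun x => f (x, y)) (P.map X))
    (hle : ∀ y, ∫ x, f (x, y) ∂(P.map X) ≤ ψ y) :
    Integrable (fun ω => f (X ω, T ω)) P ∧ ∫ ω, f (X ω, T ω) ∂P ≤ ∫ ω, ψ (T ω) ∂P := by
  have := Measure.isProbabilityMeasure_map (μ := P) hX.aemeasurable
  have := Measure.isProbabilityMeasure_map (μ := P) hT.aemeasurable
  have hmap := (indepFun_iff_map_prod_eq_prod_map_map hX.aemeasurable hT.aemeasurable).1 hXT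
  have hψ' : Integrable ψ (P.map T) :=
    (integrable_map_measure hψm.aestronglyMeasurable hT.aemeasurable).2 hψ
  have hi : Integrable f ((P.map X).prod (P.map T)) := by
    rw [integrable_prod_iff' hf.aestronglyMeasurable]
    refine ⟨.of_forall hint, hψ'.mono' ?_ (.of_forall fun y => ?_)⟩
    · exact hf.stronglyMeasurable.norm.integral_prod_left'.aestronglyMeasurable
    · rw [Real.norm_of_nonneg (integral_nonneg fun x => norm_nonneg _)]
      simp_rw [Real.norm_of_nonneg (hf0 _)]
      exact hle y
  have hi' : Integrable f (P.map fun ω => (X ω, T ω)) := by rwa [hmap]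
  refine ⟨(integrable_map_measure hf.aestronglyMeasurable
    (hX.prodMk hT).aemeasurable).1 hi', ?_⟩
  rw [← integral_map (f := f) (hX.prodMk hT).aemeasurable hf.aestronglyMeasurable, hmap,
    integral_prod_symm _ hi, ← integral_map (f := ψ) hT.aemeasurable hψm.aestronglyMeasurable]
  exact integral_mono hi.integral_prod_right hψ' hle

theorem IndepFun.integral_eq_zero_of_integral_eq_zero (hX : Measurable X) (hT : Measurable T)
    (hXT : IndepFun X T P) {f : 𝒳 × Y → ℝ} (hf : Measurable f)
    (hi : Integrable (fun ω => f (X ω, T ω)) P)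
    (hzero : ∀ y, ∫ x, f (x, y) ∂(P.map X) = 0) : ∫ ω, f (X ω, T ω) ∂P = 0 := by
  have := Measure.isProbabilityMeasure_map (μ := P) hX.aemeasurable
  have := Measure.isProbabilityMeasure_map (μ := P) hT.aemeasurable
  have hmap := (indepFun_iff_map_prod_eq_prod_map_map hX.aemeasurable hT.aemeasurable).1 hXT
  have hi' : Integrable f (P.map fun ω => (X ω, T ω)) :=
    (integrable_map_measure hf.aestronglyMeasurable (hX.prodMk hT).aemeasurable).2 hi
  rw [hmap] at hi'
  rw [← integral_map (f := f) (hX.prodMk hT).aemeasurable hf.aestronglyMeasurable, hmap,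
    integral_prod_symm _ hi']
  simp [hzero]

end Fubini

/-! ### Moments of the stochastic gradient iterates -/

/-- The random gradient `∇g(X, ·)` is an unbiased estimate of the gradient of `G = E[g(X, ·)]`, and
its moments of even order grow at most like those of `‖h - m‖`. -/
structure IsGradientOracle {𝒳 H : Type*} [MeasurableSpace 𝒳] [NormedAddCommGroup H]
    [InnerProductSpace ℝ H] [CompleteSpace H] [MeasurableSpace H] (μ : Measure 𝒳)
    (g : 𝒳 → H → ℝ) (m : H) (L : ℕ → ℝ) : Prop where
  measurable : Measurable (fun z : 𝒳 × H => gradient (g z.1) z.2)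
  unbiased : ∀ h, gradient (objective μ g) h = ∫ x, gradient (g x) h ∂μ
  pos : ∀ q, 1 ≤ q → 0 < L q
  integrable : ∀ q, 1 ≤ q → ∀ h, Integrable (fun x => ‖gradient (g x) h‖ ^ (2 * q)) μ
  integral_le : ∀ q, 1 ≤ q → ∀ h,
    ∫ x, ‖gradient (g x) h‖ ^ (2 * q) ∂μ ≤ L q * (1 + ‖h - m‖ ^ (2 * q))

/-- The contribution of the gradient of `G` is coercive, at any truncation level. -/
def IsCoerciveAt {H : Type*} [NormedAddCommGroup H] [InnerProductSpace ℝ H] [CompleteSpace H]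
    (G : H → ℝ) (m : H) (c E : ℝ) : Prop :=
  ∀ (h : H) (M : ℝ) (s : ℕ), 1 ≤ M →
    c / M * (‖h - m‖ ^ 2 - (E / M ^ 2) ^ s * (‖h - m‖ ^ 2) ^ (1 + s)) ≤ ⟪h - m, gradient G h⟫

section Oracle

variable {H : Type*} [NormedAddCommGroup H] [InnerProductSpace ℝ H] [CompleteSpace H]
  {m : H}

theorem IsCoerciveAt.inner_nonneg {G : H → ℝ} {c E : ℝ} (hc : IsCoerciveAt G m c E) (h : H) :
    0 ≤ ⟪h - m, gradient G h⟫ := by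
  -- For s = 0 and M = 1 the bracket on the left vanishes.
  simpa using hc h 1 0 le_rfl

variable [SecondCountableTopology H] [MeasurableSpace H] [BorelSpace H]
  {𝒳 : Type*} [MeasurableSpace 𝒳] {μ : Measure 𝒳} {g : 𝒳 → H → ℝ} {L : ℕ → ℝ}

theorem IsGradientOracle.memLp_two (h : IsGradientOracle μ g m L) (y : H) :
    MemLp (fun x => gradient (g x) y) 2 μ :=
  memLp_two_gradient h.measurable (by simpa using h.integrable 1 le_rfl y)

variable [IsProbabilityMeasure μ]

theorem IsGradientOracle.measurable_gradient (h : IsGradientOracle μ g m L) :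
    Measurable (gradient (objective μ g)) := by
  have := h.measurable.stronglyMeasurable.integral_prod_left' (μ := μ)
  rw [show gradient (objective μ g) = fun y => ∫ x, gradient (g x) y ∂μ from funext h.unbiased]
  exact this.measurable

/-- The moments after one step from a deterministic point. -/
theorem IsGradientOracle.exists_step_bound (ho : IsGradientOracle μ g m L) {b : ℝ} (hb : 0 ≤ b)
    (q : ℕ) :
    ∃ K : ℝ, 0 ≤ K ∧ ∀ (h : H) (γ : ℝ), 0 ≤ γ → γ ≤ b →
      Integrable (fun x => (‖h - γ • gradient (g x) h - m‖ ^ 2) ^ (q + 1)) μ ∧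
      ∫ x, (‖h - γ • gradient (g x) h - m‖ ^ 2) ^ (q + 1) ∂μ ≤
        (‖h - m‖ ^ 2) ^ (q + 1)
          - 2 * (q + 1) * γ * ((‖h - m‖ ^ 2) ^ q * ⟪h - m, gradient (objective μ g) h⟫)
          + K * γ ^ 2 * ((‖h - m‖ ^ 2) ^ q + (‖h - m‖ ^ 2) ^ (q + 1)) + K * γ ^ (2 * (q + 1)) := by
  obtain ⟨A, hA, hexp⟩ := exists_norm_sub_pow_le H q
  have hL1 := (ho.pos 1 le_rfl).le
  have hLq := (ho.pos (q + 1) (by omega)).le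
  refine ⟨A * (L 1 + L (q + 1) * (1 + b ^ (2 * q))), by positivity, fun h γ hγ hγb => ?_⟩
  set V := ‖h - m‖ ^ 2 with hV
  have hV0 : 0 ≤ V := by positivity
  have hgi : Integrable (fun x => gradient (g x) h) μ := (ho.memLp_two h).integrable (by norm_num)
  have i1 := ho.integrable 1 le_rfl h
  have i2 := ho.integrable (q + 1) (by omega) h
  have l1 := ho.integral_le 1 le_rfl h
  have l2 := ho.integral_le (q + 1) (by omega) h
  have hpt : ∀ x, (‖h - γ • gradient (g x) h - m‖ ^ 2) ^ (q + 1) ≤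
      V ^ (q + 1) - 2 * (q + 1) * γ * V ^ q * ⟪h - m, gradient (g x) h⟫
        + (A * V ^ q * γ ^ 2 * ‖gradient (g x) h‖ ^ (2 * 1)
          + A * γ ^ (2 * (q + 1)) * ‖gradient (g x) h‖ ^ (2 * (q + 1))) := by
    intro x
    have h1 := hexp (h - m) (γ • gradient (g x) h)
    rw [show h - m - γ • gradient (g x) h = h - γ • gradient (g x) h - m by abel,
      inner_smul_right, norm_smul, Real.norm_of_nonneg hγ] at h1
    refine h1.trans (le_of_eq ?_)
    rw [mul_pow, mul_pow, ← pow_mul, ← pow_mul γ, ← pow_mul]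
    ring
  have r0 : Integrable (fun x => 2 * (q + 1) * γ * V ^ q * ⟪h - m, gradient (g x) h⟫) μ :=
    (hgi.const_inner _).const_mul _
  have r1 : Integrable (fun x => V ^ (q + 1)
      - 2 * (q + 1) * γ * V ^ q * ⟪h - m, gradient (g x) h⟫) μ := (integrable_const _).sub r0
  have r2 : Integrable (fun x => A * V ^ q * γ ^ 2 * ‖gradient (g x) h‖ ^ (2 * 1)
      + A * γ ^ (2 * (q + 1)) * ‖gradient (g x) h‖ ^ (2 * (q + 1))) μ :=
    (i1.const_mul _).add (i2.const_mul _)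
  have hRi := r1.add r2
  have hmeas : Measurable (fun x => (‖h - γ • gradient (g x) h - m‖ ^ 2) ^ (q + 1)) := by
    have := measurable_gradient_left ho.measurable h
    fun_prop
  have hLi : Integrable (fun x => (‖h - γ • gradient (g x) h - m‖ ^ 2) ^ (q + 1)) μ :=
    hRi.mono' hmeas.aestronglyMeasurable (.of_forall fun x => by
      rw [Real.norm_of_nonneg (by positivity)]; exact hpt x)
  refine ⟨hLi, (integral_mono hLi hRi hpt).trans ?_⟩
  rw [integral_add' r1 r2, integral_sub (integrable_const _) r0,
    integral_add (i1.const_mul _) (i2.const_mul _), integral_const_mul, integral_const_mul,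
    integral_const_mul, integral_inner hgi, ← ho.unbiased]
  simp only [integral_const, probReal_univ, smul_eq_mul, one_mul]
  rw [mul_one, ← hV] at l1
  rw [pow_mul ‖h - m‖, ← hV] at l2
  have e1 : A * V ^ q * γ ^ 2 * ∫ x, ‖gradient (g x) h‖ ^ (2 * 1) ∂μ
      ≤ A * V ^ q * γ ^ 2 * (L 1 * (1 + V)) := by
    gcongr
  have e2 : A * γ ^ (2 * (q + 1)) * ∫ x, ‖gradient (g x) h‖ ^ (2 * (q + 1)) ∂μ
      ≤ A * γ ^ (2 * (q + 1)) * (L (q + 1) * (1 + V ^ (q + 1))) := by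
    gcongr
  -- The bound γ ≤ b is spent only on the term multiplied by V^(q+1). The constant term keeps
  -- γ^(2(q+1)), whose decay is needed for the rates of the higher moments.
  have e3 : γ ^ (2 * (q + 1)) ≤ b ^ (2 * q) * γ ^ 2 := by
    rw [mul_add, pow_add, mul_one]
    gcongr
  have e4 : A * L (q + 1) * V ^ (q + 1) * γ ^ (2 * (q + 1))
      ≤ A * L (q + 1) * V ^ (q + 1) * (b ^ (2 * q) * γ ^ 2) := by gcongr
  have p1 : 0 ≤ A * L (q + 1) * (γ ^ 2 * V ^ q + γ ^ 2 * V ^ (q + 1)) := by positivity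
  have p2 : 0 ≤ A * L 1 * γ ^ (2 * (q + 1)) := by positivity
  have p3 : 0 ≤ A * L (q + 1) * b ^ (2 * q) * (γ ^ 2 * V ^ q + γ ^ (2 * (q + 1))) := by positivity
  have e5 : A * V ^ q * γ ^ 2 * (L 1 * (1 + V))
      = A * L 1 * (γ ^ 2 * V ^ q + γ ^ 2 * V ^ (q + 1)) := by ring
  nlinarith [e1, e2, e4, p1, p2, p3, e5]

/-- The moments after one step from a random point. -/
theorem IsGradientOracle.exists_random_step_bound (ho : IsGradientOracle μ g m L) {b c E : ℝ}
    (hb : 0 ≤ b) (hc : IsCoerciveAt (objective μ g) m c E) (q : ℕ) :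
    ∃ K : ℝ, 0 ≤ K ∧ ∀ {Ω : Type*} [MeasurableSpace Ω] (P : Measure Ω) [IsProbabilityMeasure P]
      (X : Ω → 𝒳) (T : Ω → H) (γ : ℝ), Measurable X → P.map X = μ → Measurable T →
      IndepFun X T P → 0 ≤ γ → γ ≤ b →
      (∀ r : ℕ, Integrable (fun ω => (‖T ω - m‖ ^ 2) ^ r) P) →
      Integrable (fun ω => (‖T ω - γ • gradient (g (X ω)) (T ω) - m‖ ^ 2) ^ (q + 1)) P ∧
      ∀ (M : ℝ) (s : ℕ), 1 ≤ M →
        ∫ ω, (‖T ω - γ • gradient (g (X ω)) (T ω) - m‖ ^ 2) ^ (q + 1) ∂P ≤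
          ∫ ω, (‖T ω - m‖ ^ 2) ^ (q + 1) ∂P
            - 2 * c / M * γ * (∫ ω, (‖T ω - m‖ ^ 2) ^ (q + 1) ∂P
              - (E / M ^ 2) ^ s * ∫ ω, (‖T ω - m‖ ^ 2) ^ (q + 1 + s) ∂P)
            + K * γ ^ 2 * (∫ ω, (‖T ω - m‖ ^ 2) ^ q ∂P + ∫ ω, (‖T ω - m‖ ^ 2) ^ (q + 1) ∂P)
            + K * γ ^ (2 * (q + 1)) := by
  obtain ⟨K, hK, hstep⟩ := ho.exists_step_bound hb q
  refine ⟨K, hK, fun P _ X T γ hX hμ hT hXT hγ hγb hint => ?_⟩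
  have hf : Measurable (fun z : 𝒳 × H => (‖z.2 - γ • gradient (g z.1) z.2 - m‖ ^ 2) ^ (q + 1)) := by
    have := ho.measurable
    fun_prop
  have key : ∀ (M : ℝ) (s : ℕ), 1 ≤ M → _ := fun M s hM =>
    IndepFun.integral_le_of_integral_le hX hT hXT hf (fun z => by positivity)
      (ψ := fun h => (‖h - m‖ ^ 2) ^ (q + 1)
            - 2 * c / M * γ * ((‖h - m‖ ^ 2) ^ (q + 1)
              - (E / M ^ 2) ^ s * (‖h - m‖ ^ 2) ^ (q + 1 + s))
            + K * γ ^ 2 * ((‖h - m‖ ^ 2) ^ q + (‖h - m‖ ^ 2) ^ (q + 1))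
            + K * γ ^ (2 * (q + 1)))
      (by
        exact ((((hint _).sub (((hint _).sub ((hint _).const_mul _)).const_mul _)).add
          (((hint _).add (hint _)).const_mul _)).add (integrable_const _)))
      (by fun_prop) (by rw [hμ]; exact fun y => (hstep y γ hγ hγb).1)
      (by
        rw [hμ]
        refine fun h => (hstep h γ hγ hγb).2.trans ?_
        have h1 := hc h M s hM
        have h0 := hc.inner_nonneg h
        set V := ‖h - m‖ ^ 2
        have hV : 0 ≤ V := by positivity
        have h2 : γ * (V ^ q * (c / M * (V - (E / M ^ 2) ^ s * V ^ (1 + s))))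
            ≤ γ * (V ^ q * ⟪h - m, gradient (objective μ g) h⟫) := by gcongr
        have h3 : 0 ≤ γ * (V ^ q * ⟪h - m, gradient (objective μ g) h⟫) := by positivity
        have h4 : 2 * c / M * γ * (V ^ (q + 1) - (E / M ^ 2) ^ s * V ^ (q + 1 + s))
            = 2 * (γ * (V ^ q * (c / M * (V - (E / M ^ 2) ^ s * V ^ (1 + s))))) := by ring
        -- Of the factor 2(q + 1) of the drift only 2 is kept; the surplus has a favourable sign.
        have h5 : 0 ≤ (q : ℝ) * (γ * (V ^ q * ⟪h - m, gradient (objective μ g) h⟫)) := by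
          positivity
        nlinarith [h2, h4, h5])
  refine ⟨(key 1 0 le_rfl).1, fun M s hM => (key M s hM).2.trans (le_of_eq ?_)⟩
  have j1 : Integrable (fun ω => (‖T ω - m‖ ^ 2) ^ (q + 1)
      - (E / M ^ 2) ^ s * (‖T ω - m‖ ^ 2) ^ (q + 1 + s)) P := (hint _).sub ((hint _).const_mul _)
  have j2 : Integrable (fun ω => (‖T ω - m‖ ^ 2) ^ q + (‖T ω - m‖ ^ 2) ^ (q + 1)) P :=
    (hint _).add (hint _)
  have j3 : Integrable (fun ω => (‖T ω - m‖ ^ 2) ^ (q + 1) - 2 * c / M * γ *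
      ((‖T ω - m‖ ^ 2) ^ (q + 1) - (E / M ^ 2) ^ s * (‖T ω - m‖ ^ 2) ^ (q + 1 + s))) P :=
    (hint _).sub (j1.const_mul _)
  have j4 : Integrable (fun ω => (‖T ω - m‖ ^ 2) ^ (q + 1) - 2 * c / M * γ *
      ((‖T ω - m‖ ^ 2) ^ (q + 1) - (E / M ^ 2) ^ s * (‖T ω - m‖ ^ 2) ^ (q + 1 + s))
      + K * γ ^ 2 * ((‖T ω - m‖ ^ 2) ^ q + (‖T ω - m‖ ^ 2) ^ (q + 1))) P :=
    j3.add (j2.const_mul _)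
  rw [integral_add j4 (integrable_const _), integral_add j3 (j2.const_mul _),
    integral_sub (hint _) (j1.const_mul _), integral_const_mul, integral_const_mul,
    integral_sub (hint _) ((hint _).const_mul _), integral_const_mul,
    integral_add (hint _) (hint _)]
  simp

theorem stepSize_le {cγ α : ℝ} (hc : 0 ≤ cγ) (hα : 0 ≤ α) {k : ℕ} (hk : 1 ≤ k) :
    stepSize cγ α k ≤ cγ := by
  have : (k : ℝ) ^ (-α) ≤ 1 :=
    Real.rpow_le_one_of_one_le_of_nonpos (by exact_mod_cast hk) (by linarith)
  exact mul_le_of_le_one_right hc this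

/-- The constants are fixed before the probability space, the number of machines and the data; the
uniformity of the final bounds rests on this order. The starting points enter only through R. -/
theorem IsGradientOracle.exists_isMomentSystem (ho : IsGradientOracle μ g m L) {c E cγ α R : ℝ}
    (hc : IsCoerciveAt (objective μ g) m c E) (hcγ : 0 < cγ) (hα : 0 < α) :
    ∃ K U : ℕ → ℝ, (∀ q, 0 ≤ K q) ∧ ∀ {Ω : Type*} [MeasurableSpace Ω] (P : Measure Ω)
      [IsProbabilityMeasure P] {p : ℕ} (X : Fin p → ℕ → Ω → 𝒳) (m₁ : Fin p → Ω → H),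
      IsMachineData P μ R X m₁ → ∀ i : Fin p,
      (∀ q k : ℕ, 1 ≤ k → Integrable
        (fun ω => (‖sgd g cγ α (m₁ i ω) (fun l => X i l ω) k - m‖ ^ 2) ^ q) P) ∧
      IsMomentSystem (2 * c * cγ) E α K U (fun q k =>
        ∫ ω, (‖sgd g cγ α (m₁ i ω) (fun l => X i l ω) k - m‖ ^ 2) ^ q ∂P) := by
  choose K hK hstep using ho.exists_random_step_bound hcγ.le hc
  refine ⟨fun q => K q * (cγ ^ 2 + cγ ^ (2 * (q + 1))), fun q => ((|R| + ‖m‖) ^ 2) ^ q,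
    fun q => by have := hK q; positivity, fun P _ p X m₁ hD i => ?_⟩
  have hγ0 : ∀ k, 0 ≤ stepSize cγ α k := fun k => mul_nonneg hcγ.le (by positivity)
  have hTm : ∀ k, Measurable (fun ω => sgd g cγ α (m₁ i ω) (fun l => X i l ω) (k + 1)) := fun k =>
    measurable_sgd ho.measurable (hD.measurable_start i) k
      fun l _ => hD.measurable_data i _ (by omega)
  have hXm : ∀ k, Measurable (X i (k + 2)) := fun k => hD.measurable_data i _ (by omega)
  have hbd : ∀ q : ℕ, ∀ᵐ ω ∂P, (‖m₁ i ω - m‖ ^ 2) ^ q ≤ ((|R| + ‖m‖) ^ 2) ^ q := fun q => by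
    filter_upwards [hD.bounded_start i] with ω hω
    gcongr
    exact (norm_sub_le _ _).trans (by linarith [le_abs_self R])
  -- The induction on k treats all orders q at once, since one step for a given order calls on
  -- higher moments of the previous iterate.
  have hint : ∀ k q : ℕ, Integrable
      (fun ω => (‖sgd g cγ α (m₁ i ω) (fun l => X i l ω) (k + 1) - m‖ ^ 2) ^ q) P := by
    intro k
    induction k with
    | zero =>
      intro q
      have hm : Measurable (fun ω => (‖m₁ i ω - m‖ ^ 2) ^ q) := by
        have := hD.measurable_start i
        fun_prop
      refine (integrable_const (((|R| + ‖m‖) ^ 2) ^ q)).mono' hm.aestronglyMeasurable ?_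
      filter_upwards [hbd q] with ω hω
      rw [Real.norm_of_nonneg (by positivity)]
      exact hω
    | succ k ih =>
      intro q
      cases q with
      | zero => simp
      | succ q =>
        exact (hstep q P (X i (k + 2)) _ (stepSize cγ α (k + 1)) (hXm k)
          (hD.law_data i _ (by omega)) (hTm k) (hD.indepFun_sgd ho.measurable i k) (hγ0 _)
          (stepSize_le hcγ.le hα.le (by omega)) ih).1
  refine ⟨fun q k hk => ?_, ?_⟩
  · obtain ⟨k, rfl⟩ : ∃ k', k = k' + 1 := ⟨k - 1, by omega⟩
    exact hint k q
  · refine ⟨fun q k hk => integral_nonneg fun ω => by positivity, fun k hk => by simp,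
      fun q k hk => ?_, fun q => ?_, fun q s k M hk hM => ?_⟩
    · obtain ⟨k, rfl⟩ : ∃ k', k = k' + 1 := ⟨k - 1, by omega⟩
      have h1 : ∀ V : ℝ, 0 ≤ V → V ^ q ≤ 1 + V ^ (q + 1) := fun V hV => by
        rcases le_total V 1 with h | h
        · have := pow_le_one₀ (n := q) hV h
          have : 0 ≤ V ^ (q + 1) := by positivity
          linarith
        · have := pow_le_pow_right₀ h (Nat.le_succ q)
          simp only [Nat.succ_eq_add_one] at this
          linarith
      have h2 := integral_mono (hint k q) ((integrable_const 1).add (hint k (q + 1)))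
        fun ω => h1 _ (by positivity)
      have h3 := integral_add (integrable_const (1 : ℝ)) (hint k (q + 1))
      simp only [integral_const, probReal_univ, smul_eq_mul, mul_one] at h3
      rw [← h3]
      exact h2
    · have h2 := integral_mono_ae (hint 0 q) (integrable_const _) (hbd q)
      simpa using h2
    · obtain ⟨k, rfl⟩ : ∃ k', k = k' + 1 := ⟨k - 1, by omega⟩
      have h1 := (hstep q P (X i (k + 2)) _ (stepSize cγ α (k + 1)) (hXm k)
          (hD.law_data i _ (by omega)) (hTm k) (hD.indepFun_sgd ho.measurable i k) (hγ0 _)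
          (stepSize_le hcγ.le hα.le (by omega)) (hint k)).2 M s hM
      have hk0 : (0 : ℝ) ≤ ((k + 1 : ℕ) : ℝ) := by positivity
      have e1 : stepSize cγ α (k + 1) ^ 2 = cγ ^ 2 * ((k + 1 : ℕ) : ℝ) ^ (-(2 * α)) := by
        rw [stepSize, mul_pow, ← Real.rpow_natCast (((k + 1 : ℕ) : ℝ) ^ (-α)),
          ← Real.rpow_mul hk0]
        push_cast; ring_nf
      have e2 : stepSize cγ α (k + 1) ^ (2 * (q + 1))
          = cγ ^ (2 * (q + 1)) * ((k + 1 : ℕ) : ℝ) ^ (-(2 * α * (q + 1))) := by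
        rw [stepSize, mul_pow, ← Real.rpow_natCast (((k + 1 : ℕ) : ℝ) ^ (-α)),
          ← Real.rpow_mul hk0]
        push_cast; ring_nf
      have e3 : 2 * c / M * stepSize cγ α (k + 1)
          = 2 * c * cγ / M * ((k + 1 : ℕ) : ℝ) ^ (-α) := by
        rw [stepSize]; ring
      rw [e1, e2, e3] at h1
      refine h1.trans ?_
      have hw : ∀ q, 0 ≤ ∫ ω, (‖sgd g cγ α (m₁ i ω) (fun l => X i l ω) (k + 1) - m‖ ^ 2) ^ q ∂P :=
        fun q => integral_nonneg fun ω => by positivity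
      have hKq := hK q
      have hsum := add_nonneg (hw q) (hw (q + 1))
      have f1 : K q * (cγ ^ 2 * ((k + 1 : ℕ) : ℝ) ^ (-(2 * α)))
          ≤ K q * (cγ ^ 2 + cγ ^ (2 * (q + 1))) * ((k + 1 : ℕ) : ℝ) ^ (-(2 * α)) := by
        rw [← mul_assoc]
        gcongr
        have : 0 ≤ cγ ^ (2 * (q + 1)) := by positivity
        linarith
      have f2 : K q * (cγ ^ (2 * (q + 1)) * ((k + 1 : ℕ) : ℝ) ^ (-(2 * α * (q + 1))))
          ≤ K q * (cγ ^ 2 + cγ ^ (2 * (q + 1))) * ((k + 1 : ℕ) : ℝ) ^ (-(2 * α * (q + 1))) := by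
        rw [← mul_assoc]
        gcongr
        have : 0 ≤ cγ ^ 2 := by positivity
        linarith
      have f3 := mul_le_mul_of_nonneg_right f1 hsum
      linarith [f3, f2]

end Oracle

/-! ### Power sums and summation by parts -/

/-- Bernoulli's inequality for the exponent 1 - α ≤ 1 bounds each term by an increment of
x^(1-α)/(1-α), and these telescope. -/
theorem sum_range_rpow_neg_le {α : ℝ} (hα : 0 ≤ α) (hα' : α < 1) (n : ℕ) :
    ∑ j ∈ Finset.range n, ((j + 1 : ℕ) : ℝ) ^ (-α) ≤ (n : ℝ) ^ (1 - α) / (1 - α) := by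
  induction n with
  | zero => simp [Real.zero_rpow (by linarith : 1 - α ≠ 0)]
  | succ n ih =>
    rw [Finset.sum_range_succ]
    have h1α : 0 < 1 - α := by linarith
    set x : ℝ := ((n + 1 : ℕ) : ℝ) with hx
    have hx1 : 1 ≤ x := by rw [hx]; push_cast; linarith [(Nat.cast_nonneg n : (0 : ℝ) ≤ n)]
    have hx0 : 0 < x := by linarith
    have hb := rpow_one_add_le_one_add_mul_self (s := -(1 / x)) (p := 1 - α)
      (by rw [neg_le_neg_iff]; exact (div_le_one hx0).2 hx1) h1α.le (by linarith)
    have hn : (n : ℝ) = x * (1 + -(1 / x)) := by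
      rw [hx]; push_cast; field_simp; ring
    have h2 : (n : ℝ) ^ (1 - α) ≤ x ^ (1 - α) * (1 + (1 - α) * -(1 / x)) := by
      rw [hn, Real.mul_rpow hx0.le]
      · gcongr
      · have := (div_le_one hx0).2 hx1
        linarith
    have h3 : x ^ (1 - α) * (1 / x) = x ^ (-α) := by
      rw [mul_one_div, ← Real.rpow_sub_one hx0.ne']; ring_nf
    rw [le_div_iff₀ h1α] at ih ⊢
    nlinarith [h2, h3, ih]

/-- With x = (j+2)^(α/2) and y = (j+1)^(α/2), each term is (x² - y²)/x ≤ 2(x - y), which telescopes.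
-/
theorem sum_range_rpow_sub_mul_le {α : ℝ} (hα : 0 ≤ α) (n : ℕ) :
    ∑ j ∈ Finset.range n, (((j + 2 : ℕ) : ℝ) ^ α - ((j + 1 : ℕ) : ℝ) ^ α)
      * ((j + 2 : ℕ) : ℝ) ^ (-(α / 2)) ≤ 2 * ((n + 1 : ℕ) : ℝ) ^ (α / 2) := by
  have hdiff : ∀ j ∈ Finset.range n, (((j + 2 : ℕ) : ℝ) ^ α - ((j + 1 : ℕ) : ℝ) ^ α)
      * ((j + 2 : ℕ) : ℝ) ^ (-(α / 2))
      ≤ 2 * (((j + 1 + 1 : ℕ) : ℝ) ^ (α / 2) - ((j + 1 : ℕ) : ℝ) ^ (α / 2)) := by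
    intro j _
    have e : ∀ k : ℕ, (k : ℝ) ^ α = ((k : ℝ) ^ (α / 2)) ^ 2 := fun k => by
      rw [← Real.rpow_natCast, ← Real.rpow_mul (by positivity)]; norm_num
    have hx : (0 : ℝ) < ((j + 2 : ℕ) : ℝ) ^ (α / 2) := by positivity
    have hxy : ((j + 1 : ℕ) : ℝ) ^ (α / 2) ≤ ((j + 2 : ℕ) : ℝ) ^ (α / 2) := by
      gcongr; norm_num
    rw [e, e, Real.rpow_neg (by positivity), ← div_eq_mul_inv, div_le_iff₀ hx]
    nlinarith [mul_self_nonneg (((j + 2 : ℕ) : ℝ) ^ (α / 2) - ((j + 1 : ℕ) : ℝ) ^ (α / 2))]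
  refine (Finset.sum_le_sum hdiff).trans ?_
  rw [← Finset.mul_sum, Finset.sum_range_sub (fun j : ℕ => ((j + 1 : ℕ) : ℝ) ^ (α / 2))]
  have : (0 : ℝ) ≤ ((0 + 1 : ℕ) : ℝ) ^ (α / 2) := by positivity
  linarith

/-- This is the power mean inequality. It removes the dependence on the individual n_i and produces
the powers of p in the A_j. -/
theorem sum_rpow_le_card_rpow_mul {p : ℕ} {s : ℝ} (hs : 0 < s) (hs1 : s ≤ 1) (n : Fin p → ℕ) :
    ∑ i, (n i : ℝ) ^ s ≤ (p : ℝ) ^ (1 - s) * ((∑ i, n i : ℕ) : ℝ) ^ s := by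
  have h1 := Real.rpow_sum_le_const_mul_sum_rpow_of_nonneg (s := Finset.univ)
    (f := fun i => (n i : ℝ) ^ s) (p := 1 / s) ((one_le_div hs).2 hs1)
    (fun i _ => by positivity)
  have e1 : ∀ i, ((n i : ℝ) ^ s) ^ (1 / s) = n i := fun i => by
    rw [← Real.rpow_mul (by positivity), mul_one_div_cancel hs.ne', Real.rpow_one]
  simp only [e1, Finset.card_univ, Fintype.card_fin] at h1
  have hS : 0 ≤ ∑ i, (n i : ℝ) ^ s := Finset.sum_nonneg fun i _ => by positivity
  have h2 := Real.rpow_le_rpow (by positivity) h1 hs.le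
  rw [← Real.rpow_mul hS, one_div_mul_cancel hs.ne', Real.rpow_one,
    Real.mul_rpow (by positivity) (by positivity), ← Real.rpow_mul (by positivity)] at h2
  push_cast
  convert h2 using 3
  field_simp

theorem natCast_smul_runningAverage {H : Type*} [NormedAddCommGroup H] [InnerProductSpace ℝ H]
    (u : ℕ → H) {n : ℕ} (hn : 1 ≤ n) :
    (n : ℝ) • runningAverage u n = ∑ j ∈ Finset.range n, u (j + 1) := by
  induction n, hn using Nat.le_induction with
  | base => simp [runningAverage]
  | succ n hn ih =>
    obtain ⟨k, rfl⟩ : ∃ k, n = k + 1 := ⟨n - 1, by omega⟩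
    rw [Finset.sum_range_succ, ← ih, runningAverage, smul_add, smul_smul]
    have : ((k + 1 + 1 : ℕ) : ℝ) * (1 / ((k : ℝ) + 2)) = 1 := by
      push_cast; field_simp; ring
    rw [this, one_smul]
    push_cast
    module

theorem sum_smul_sub_succ {H : Type*} [AddCommGroup H] [Module ℝ H] (c : ℕ → ℝ) (T : ℕ → H)
    (n : ℕ) :
    ∑ j ∈ Finset.range (n + 1), c (j + 1) • (T (j + 1) - T (j + 2)) =
      c 1 • T 1 - c (n + 1) • T (n + 2)
        + ∑ j ∈ Finset.range n, (c (j + 2) - c (j + 1)) • T (j + 2) := by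
  induction n with
  | zero => simp [smul_sub]
  | succ n ih =>
    rw [Finset.sum_range_succ, ih, Finset.sum_range_succ _ n]
    module

/-! ### L² norms and the drift of the averaged recursion -/

section LTwo

variable {Ω H : Type*} [MeasurableSpace Ω] [NormedAddCommGroup H] {P : Measure Ω}

theorem lpNorm_two_eq_sqrt {f : Ω → H} (hf : AEStronglyMeasurable f P) :
    lpNorm f 2 P = √(∫ ω, ‖f ω‖ ^ 2 ∂P) := by
  rw [lpNorm_eq_integral_norm_rpow_toReal (by norm_num) (by norm_num) hf, Real.sqrt_eq_rpow]
  norm_num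

theorem integrable_inner_of_memLp_two [InnerProductSpace ℝ H] {f g : Ω → H} (hf : MemLp f 2 P)
    (hg : MemLp g 2 P) : Integrable (fun ω => ⟪f ω, g ω⟫) P := by
  refine (hf.integrable_norm_pow (by norm_num)).add (hg.integrable_norm_pow (by norm_num))
    |>.mono' (hf.1.inner hg.1) (.of_forall fun ω => ?_)
  refine (norm_inner_le_norm _ _).trans ?_
  simp only [Pi.add_apply]
  nlinarith [sq_nonneg (‖f ω‖ - ‖g ω‖), sq_nonneg ‖f ω‖, sq_nonneg ‖g ω‖]

theorem integral_norm_sq_sum_of_orthogonal [InnerProductSpace ℝ H] {ι : Type*} (s : Finset ι)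
    {f : ι → Ω → H} (hf : ∀ i ∈ s, MemLp (f i) 2 P)
    (ho : ∀ i ∈ s, ∀ j ∈ s, i ≠ j → ∫ ω, ⟪f i ω, f j ω⟫ ∂P = 0) :
    ∫ ω, ‖∑ i ∈ s, f i ω‖ ^ 2 ∂P = ∑ i ∈ s, ∫ ω, ‖f i ω‖ ^ 2 ∂P := by
  simp_rw [← real_inner_self_eq_norm_sq, sum_inner, inner_sum]
  rw [integral_finsetSum _ fun i hi => integrable_finsetSum _ fun j hj =>
    integrable_inner_of_memLp_two (hf i hi) (hf j hj)]
  refine Finset.sum_congr rfl fun i hi => ?_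
  rw [integral_finsetSum _ fun j hj => integrable_inner_of_memLp_two (hf i hi) (hf j hj)]
  exact Finset.sum_eq_single i (fun j hj hji => ho i hi j hj hji.symm) fun h => (h hi).elim

end LTwo

section Drift

variable {Ω H : Type*} [MeasurableSpace Ω] [NormedAddCommGroup H] [NormedSpace ℝ H] {P : Measure Ω}

theorem lpNorm_const_smul_real_le {f : Ω → H} {c B : ℝ} (hc : 0 ≤ c) (h : lpNorm f 2 P ≤ B) :
    lpNorm (c • f) 2 P ≤ c * B := by
  rw [lpNorm_const_smul, coe_nnnorm, Real.norm_of_nonneg hc]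
  gcongr

/-- The part of the averaged recursion that is not a martingale, after summation by parts. -/
noncomputable def drift (cγ α : ℝ) (T δ : ℕ → Ω → H) (n : ℕ) : Ω → H :=
  (cγ⁻¹ * ((1 : ℕ) : ℝ) ^ α) • T 1 - (cγ⁻¹ * ((n + 1 : ℕ) : ℝ) ^ α) • T (n + 2)
    + ∑ j ∈ Finset.range n,
        (cγ⁻¹ * ((j + 2 : ℕ) : ℝ) ^ α - cγ⁻¹ * ((j + 1 : ℕ) : ℝ) ^ α) • T (j + 2)
    - ∑ j ∈ Finset.range (n + 1), δ (j + 1)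

theorem memLp_drift {cγ α : ℝ} {T δ : ℕ → Ω → H} (hT : ∀ k, 1 ≤ k → MemLp (T k) 2 P)
    (hδ : ∀ k, 1 ≤ k → MemLp (δ k) 2 P) (n : ℕ) : MemLp (drift cγ α T δ n) 2 P :=
  ((((hT _ le_rfl).const_smul _).sub ((hT _ (by omega)).const_smul _)).add
    (memLp_finsetSum' _ fun j _ => (hT _ (by omega)).const_smul _)).sub
    (memLp_finsetSum' _ fun j _ => hδ _ (by omega))

/-- Minkowski's inequality is applied to each part. Since `T k` has size k^(-α/2), the final
boundary term counts once and the telescoping sum twice the power (n+1)^(α/2), whence the factor 3.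
-/
theorem lpNorm_drift_le {cγ α b₁ b₂ : ℝ} (hcγ : 0 < cγ) (hα : 0 ≤ α) (hα' : α < 1) (hb₁ : 0 ≤ b₁)
    (hb₂ : 0 ≤ b₂) {T δ : ℕ → Ω → H} (hT : ∀ k, 1 ≤ k → MemLp (T k) 2 P)
    (hδ : ∀ k, 1 ≤ k → MemLp (δ k) 2 P)
    (hTb : ∀ k : ℕ, 1 ≤ k → lpNorm (T k) 2 P ≤ b₁ * (k : ℝ) ^ (-(α / 2)))
    (hδb : ∀ k : ℕ, 1 ≤ k → lpNorm (δ k) 2 P ≤ b₂ * (k : ℝ) ^ (-α)) (n : ℕ) :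
    lpNorm (drift cγ α T δ n) 2 P ≤ cγ⁻¹ * b₁ + 3 * (cγ⁻¹ * b₁ * ((n + 1 : ℕ) : ℝ) ^ (α / 2))
      + b₂ * (((n + 1 : ℕ) : ℝ) ^ (1 - α) / (1 - α)) := by
  have m1 : MemLp ((cγ⁻¹ * ((1 : ℕ) : ℝ) ^ α) • T 1) 2 P := (hT _ le_rfl).const_smul _
  have m2 : MemLp ((cγ⁻¹ * ((n + 1 : ℕ) : ℝ) ^ α) • T (n + 2)) 2 P :=
    (hT _ (by omega)).const_smul _
  have m3 : ∀ j ∈ Finset.range n, MemLp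
      ((cγ⁻¹ * ((j + 2 : ℕ) : ℝ) ^ α - cγ⁻¹ * ((j + 1 : ℕ) : ℝ) ^ α) • T (j + 2)) 2 P :=
    fun j _ => (hT _ (by omega)).const_smul _
  have m4 : ∀ j ∈ Finset.range (n + 1), MemLp (δ (j + 1)) 2 P := fun j _ => hδ _ (by omega)
  have h1 := lpNorm_sub_le ((m1.sub m2).add (memLp_finsetSum' _ m3)) (by norm_num : (1 : ENNReal) ≤ 2)
    (g := ∑ j ∈ Finset.range (n + 1), δ (j + 1))
  have h2 := lpNorm_add_le (m1.sub m2) (by norm_num : (1 : ENNReal) ≤ 2) (g := ∑ j ∈ Finset.range n,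
        (cγ⁻¹ * ((j + 2 : ℕ) : ℝ) ^ α - cγ⁻¹ * ((j + 1 : ℕ) : ℝ) ^ α) • T (j + 2))
  have h3 := lpNorm_sub_le m1 (by norm_num : (1 : ENNReal) ≤ 2)
    (g := (cγ⁻¹ * ((n + 1 : ℕ) : ℝ) ^ α) • T (n + 2))
  have h4 := lpNorm_sum_le m3 (by norm_num)
  have h5 := lpNorm_sum_le m4 (by norm_num)
  have k1 : lpNorm ((cγ⁻¹ * ((1 : ℕ) : ℝ) ^ α) • T 1) 2 P ≤ cγ⁻¹ * b₁ := by
    have := lpNorm_const_smul_real_le (c := cγ⁻¹ * ((1 : ℕ) : ℝ) ^ α) (by positivity)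
      (hTb 1 le_rfl)
    simpa using this
  have k2 : lpNorm ((cγ⁻¹ * ((n + 1 : ℕ) : ℝ) ^ α) • T (n + 2)) 2 P
      ≤ cγ⁻¹ * b₁ * ((n + 1 : ℕ) : ℝ) ^ (α / 2) := by
    have hn0 : (0 : ℝ) < ((n + 1 : ℕ) : ℝ) := by positivity
    refine (lpNorm_const_smul_real_le (c := cγ⁻¹ * ((n + 1 : ℕ) : ℝ) ^ α) (by positivity)
      (hTb (n + 2) (by omega))).trans ?_
    have e1 : ((n + 2 : ℕ) : ℝ) ^ (-(α / 2)) ≤ ((n + 1 : ℕ) : ℝ) ^ (-(α / 2)) :=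
      Real.rpow_le_rpow_of_nonpos hn0 (by push_cast; linarith) (by linarith)
    have e2 : ((n + 1 : ℕ) : ℝ) ^ α * ((n + 1 : ℕ) : ℝ) ^ (-(α / 2))
        = ((n + 1 : ℕ) : ℝ) ^ (α / 2) := by
      rw [← Real.rpow_add hn0]; ring_nf
    calc _ ≤ cγ⁻¹ * ((n + 1 : ℕ) : ℝ) ^ α * (b₁ * ((n + 1 : ℕ) : ℝ) ^ (-(α / 2))) := by gcongr
      _ = cγ⁻¹ * b₁ * (((n + 1 : ℕ) : ℝ) ^ α * ((n + 1 : ℕ) : ℝ) ^ (-(α / 2))) := by ring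
      _ = _ := by rw [e2]
  have k3 : ∑ j ∈ Finset.range n, lpNorm
      ((cγ⁻¹ * ((j + 2 : ℕ) : ℝ) ^ α - cγ⁻¹ * ((j + 1 : ℕ) : ℝ) ^ α) • T (j + 2)) 2 P
      ≤ cγ⁻¹ * b₁ * (2 * ((n + 1 : ℕ) : ℝ) ^ (α / 2)) := by
    refine le_trans ?_ (mul_le_mul_of_nonneg_left (sum_range_rpow_sub_mul_le hα n)
      (by positivity))
    rw [Finset.mul_sum]
    refine Finset.sum_le_sum fun j _ => ?_
    have hmono : ((j + 1 : ℕ) : ℝ) ^ α ≤ ((j + 2 : ℕ) : ℝ) ^ α := by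
      gcongr; norm_num
    refine (lpNorm_const_smul_real_le (by
      rw [← mul_sub]; exact mul_nonneg (by positivity) (by linarith))
      (hTb (j + 2) (by omega))).trans (le_of_eq (by ring))
  have k4 : ∑ j ∈ Finset.range (n + 1), lpNorm (δ (j + 1)) 2 P
      ≤ b₂ * (((n + 1 : ℕ) : ℝ) ^ (1 - α) / (1 - α)) := by
    refine le_trans ?_ (mul_le_mul_of_nonneg_left (sum_range_rpow_neg_le hα hα' (n + 1)) hb₂)
    rw [Finset.mul_sum]
    exact Finset.sum_le_sum fun j _ => hδb _ (by omega)
  unfold drift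
  linarith

end Drift

/-! ### Algebra of the explicit bound -/

section Quadratic

variable {lam cγ α Cm L₁ C₁ C₂ : ℝ} {p n : ℕ}

theorem remainderSq_nonneg (hα : 0 ≤ α) (hα' : α ≤ 1) (hL : 0 ≤ L₁)
    (hC₁ : 0 ≤ C₁) (hC₂ : 0 ≤ C₂) (j : Fin 6) : 0 ≤ remainderSq cγ α Cm L₁ C₁ C₂ p n j := by
  have h1 : 0 ≤ 1 - α := by linarith
  have h2 : 0 ≤ (1 - α)⁻¹ := inv_nonneg.2 h1
  have h3 : 0 ≤ (1 - α) ^ (-2 : ℤ) := zpow_nonneg h1 _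
  have h4 : 0 ≤ cγ ^ (-2 : ℤ) := by
    rw [zpow_neg]; exact inv_nonneg.2 (by positivity)
  match j with
  | 0 | 1 | 2 | 3 | 4 | 5 => simp only [remainderSq, Matrix.cons_val]; positivity

/-- The explicit bound is the square of the sum of the `A_j`, up to the factor `λ⁻²`. -/
theorem quadraticBound_eq_sq (hα : 0 ≤ α) (hα' : α ≤ 1) (hL : 0 ≤ L₁)
    (hC₁ : 0 ≤ C₁) (hC₂ : 0 ≤ C₂) :
    quadraticBound lam cγ α Cm L₁ C₁ C₂ p n
      = lam ^ (-2 : ℤ) * (∑ j, √(remainderSq cγ α Cm L₁ C₁ C₂ p n j)) ^ 2 := by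
  have hsq : ∀ j, remainderSq cγ α Cm L₁ C₁ C₂ p n j
      = √(remainderSq cγ α Cm L₁ C₁ C₂ p n j) ^ 2 := fun j =>
    (Real.sq_sqrt (remainderSq_nonneg hα hα' hL hC₁ hC₂ j)).symm
  have h5 : L₁ * lam ^ (-2 : ℤ) / (n : ℝ)
      = lam ^ (-2 : ℤ) * √(remainderSq cγ α Cm L₁ C₁ C₂ p n (Fin.last 5)) ^ 2 := by
    rw [← hsq]
    change _ = lam ^ (-2 : ℤ) * (L₁ / (n : ℝ))
    ring
  unfold quadraticBound
  have h7 : ∑ j : Fin 5, lam ^ (-2 : ℤ) * remainderSq cγ α Cm L₁ C₁ C₂ p n j.castSucc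
      = ∑ j : Fin 5, lam ^ (-2 : ℤ) * √(remainderSq cγ α Cm L₁ C₁ C₂ p n j.castSucc) ^ 2 :=
    Finset.sum_congr rfl fun j _ => congrArg _ (hsq _)
  rw [h5, h7]
  have h6 : ∀ j : Fin 6, ∑ j' ∈ Finset.univ.erase j,
      lam ^ (-2 : ℤ) * √(remainderSq cγ α Cm L₁ C₁ C₂ p n j)
        * √(remainderSq cγ α Cm L₁ C₁ C₂ p n j')
      = lam ^ (-2 : ℤ) * √(remainderSq cγ α Cm L₁ C₁ C₂ p n j)
        * (∑ j', √(remainderSq cγ α Cm L₁ C₁ C₂ p n j')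
          - √(remainderSq cγ α Cm L₁ C₁ C₂ p n j)) := fun j => by
    rw [← Finset.mul_sum, Finset.sum_erase_eq_sub (Finset.mem_univ j)]
  simp_rw [h6]
  rw [add_comm (lam ^ (-2 : ℤ) * _), ← Fin.sum_univ_castSucc
    (f := fun j => lam ^ (-2 : ℤ) * √(remainderSq cγ α Cm L₁ C₁ C₂ p n j) ^ 2),
    ← Finset.sum_add_distrib, sq, ← mul_assoc, Finset.mul_sum]
  refine Finset.sum_congr rfl fun j _ => ?_
  ring

/-- Comparison of the bounds obtained for the parts of the averaged recursion with the `A_j`. -/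
theorem bound_le_sum_sqrt_remainderSq {c₁ : ℝ} (hcγ : 0 < cγ) (hα : 1 / 2 < α) (hα' : α < 1)
    (hL : 0 ≤ L₁) (hc₁ : 0 ≤ c₁) (hC₂ : 0 ≤ C₂) (hn : 0 < n) :
    1 / (n : ℝ) * (p * (cγ⁻¹ * √c₁)
        + 3 * (cγ⁻¹ * √c₁ * ((p : ℝ) ^ (1 - α / 2) * (n : ℝ) ^ (α / 2)))
        + Cm * √C₂ * ((p : ℝ) ^ α * (n : ℝ) ^ (1 - α) / (1 - α))
        + √(L₁ * (n + c₁ * ((p : ℝ) ^ α * (n : ℝ) ^ (1 - α) / (1 - α)))))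
      ≤ ∑ j, √(remainderSq cγ α Cm L₁ (9 * c₁) C₂ p n j) := by
  have hn0 : (0 : ℝ) < n := by exact_mod_cast hn
  have h1α : 0 < 1 - α := by linarith
  have hp0 : (0 : ℝ) ≤ p := by positivity
  have hzc : cγ ^ (-2 : ℤ) = (cγ⁻¹) ^ 2 := by
    rw [zpow_neg, inv_pow]; norm_cast
  have hza : (1 - α) ^ (-2 : ℤ) = ((1 - α)⁻¹) ^ 2 := by
    rw [zpow_neg, inv_pow]; norm_cast
  have hs1 : √c₁ ^ 2 = c₁ := Real.sq_sqrt hc₁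
  have hs2 : √C₂ ^ 2 = C₂ := Real.sq_sqrt hC₂
  have g0 : 1 / (n : ℝ) * (p * (cγ⁻¹ * √c₁))
      ≤ √(remainderSq cγ α Cm L₁ (9 * c₁) C₂ p n 0) := by
    apply Real.le_sqrt_of_sq_le
    simp only [remainderSq, Matrix.cons_val]
    rw [hzc]
    calc _ = (p : ℝ) ^ 2 * √c₁ ^ 2 * (cγ⁻¹) ^ 2 / (n : ℝ) ^ 2 := by ring
      _ ≤ _ := by rw [hs1]; gcongr; linarith
  -- The factor 3 is absorbed by the constant 9 c₁ in place of c₁; then 4α ≥ 1 suffices.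
  have g2 : 1 / (n : ℝ) * (3 * (cγ⁻¹ * √c₁ * ((p : ℝ) ^ (1 - α / 2) * (n : ℝ) ^ (α / 2))))
      ≤ √(remainderSq cγ α Cm L₁ (9 * c₁) C₂ p n 2) := by
    apply Real.le_sqrt_of_sq_le
    simp only [remainderSq, Matrix.cons_val]
    rw [hzc]
    have e1 : ((p : ℝ) ^ (1 - α / 2)) ^ 2 = (p : ℝ) ^ (2 - α) := by
      rw [← Real.rpow_natCast, ← Real.rpow_mul hp0]; ring_nf
    have e2 : ((n : ℝ) ^ (α / 2)) ^ 2 = (n : ℝ) ^ 2 / (n : ℝ) ^ (2 - α) := by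
      rw [← Real.rpow_natCast, ← Real.rpow_mul hn0.le, ← Real.rpow_natCast,
        ← Real.rpow_sub hn0]
      push_cast; ring_nf
    calc _ = 1 / (n : ℝ) ^ 2 * 9 * (cγ⁻¹) ^ 2 * √c₁ ^ 2 * ((p : ℝ) ^ (1 - α / 2)) ^ 2
          * ((n : ℝ) ^ (α / 2)) ^ 2 := by ring
      _ = 1 * (p : ℝ) ^ (2 - α) * (cγ⁻¹) ^ 2 * (9 * c₁) / (n : ℝ) ^ (2 - α) := by
          rw [e1, e2, hs1]; field_simp
      _ ≤ 4 * α * (p : ℝ) ^ (2 - α) * (cγ⁻¹) ^ 2 * (9 * c₁) / (n : ℝ) ^ (2 - α) := by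
          gcongr; linarith
      _ = _ := by ring
  have epn : ((p : ℝ) ^ α) ^ 2 = (p : ℝ) ^ (2 * α) := by
    rw [← Real.rpow_natCast, ← Real.rpow_mul hp0]; push_cast; ring_nf
  have g3 : 1 / (n : ℝ) * (Cm * √C₂ * ((p : ℝ) ^ α * (n : ℝ) ^ (1 - α) / (1 - α)))
      ≤ √(remainderSq cγ α Cm L₁ (9 * c₁) C₂ p n 3) := by
    apply Real.le_sqrt_of_sq_le
    simp only [remainderSq, Matrix.cons_val]
    have e2 : ((n : ℝ) ^ (1 - α)) ^ 2 = (n : ℝ) ^ 2 / (n : ℝ) ^ (2 * α) := by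
      rw [← Real.rpow_natCast, ← Real.rpow_mul hn0.le, ← Real.rpow_natCast,
        ← Real.rpow_sub hn0]
      push_cast; ring_nf
    rw [hza]
    refine le_of_eq ?_
    calc _ = 1 / (n : ℝ) ^ 2 * Cm ^ 2 * √C₂ ^ 2 * ((p : ℝ) ^ α) ^ 2 * ((n : ℝ) ^ (1 - α)) ^ 2
          * ((1 - α)⁻¹) ^ 2 := by ring
      _ = _ := by rw [epn, e2, hs2]; field_simp
  have g4 : 1 / (n : ℝ) * √(L₁ * (n + c₁ * ((p : ℝ) ^ α * (n : ℝ) ^ (1 - α) / (1 - α))))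
      ≤ √(remainderSq cγ α Cm L₁ (9 * c₁) C₂ p n 4)
        + √(remainderSq cγ α Cm L₁ (9 * c₁) C₂ p n 5) := by
    have hadd : ∀ {x y : ℝ}, 0 ≤ x → 0 ≤ y → √(x + y) ≤ √x + √y := fun {x y} hx hy =>
      Real.sqrt_le_iff.2 ⟨by positivity, by
        nlinarith [Real.sq_sqrt hx, Real.sq_sqrt hy, mul_nonneg (Real.sqrt_nonneg x) (Real.sqrt_nonneg y)]⟩
    refine le_trans ?_ (hadd
      (remainderSq_nonneg (by linarith) hα'.le hL (by linarith) hC₂ 4)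
      (remainderSq_nonneg (by linarith) hα'.le hL (by linarith) hC₂ 5))
    apply Real.le_sqrt_of_sq_le
    rw [mul_pow, Real.sq_sqrt (by positivity)]
    simp only [remainderSq, Matrix.cons_val]
    have e2 : (n : ℝ) ^ (1 - α) = (n : ℝ) ^ 2 / (n : ℝ) ^ (1 + α) := by
      rw [← Real.rpow_natCast, ← Real.rpow_sub hn0]
      push_cast; ring_nf
    rw [e2]
    calc _ = L₁ * c₁ * (1 - α)⁻¹ * (p : ℝ) ^ α / (n : ℝ) ^ (1 + α) + L₁ / n := by
          field_simp
          ring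
      _ ≤ _ := by gcongr; linarith
  -- A_2 enters only by its sign: the final boundary terms are already counted in A_3.
  have g1 := Real.sqrt_nonneg (remainderSq cγ α Cm L₁ (9 * c₁) C₂ p n 1)
  rw [Fin.sum_univ_six]
  linarith

end Quadratic

/-! ### Gradient noise and the averaged estimate -/

/-- The centred gradient noise of machine `i` in the step from `m_{i, k + 1}` to `m_{i, k + 2}`. -/
noncomputable def gradientNoise {Ω 𝒳 H : Type*} [MeasurableSpace 𝒳] [NormedAddCommGroup H]
    [InnerProductSpace ℝ H] [CompleteSpace H] (μ : Measure 𝒳) (g : 𝒳 → H → ℝ) (cγ α : ℝ) {p : ℕ}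
    (X : Fin p → ℕ → Ω → 𝒳) (m₁ : Fin p → Ω → H) (i : Fin p) (k : ℕ) (ω : Ω) : H :=
  gradient (g (X i (k + 2) ω)) (sgd g cγ α (m₁ i ω) (fun l => X i l ω) (k + 1))
    - gradient (objective μ g) (sgd g cγ α (m₁ i ω) (fun l => X i l ω) (k + 1))

/-- Multiplying each step by γ_k⁻¹ expresses the random gradient as γ_k⁻¹(T_k - T_{k+1}), and Abel
summation gives the first part of `drift`. Splitting that gradient into A T_k, the linearisation
error and the noise leaves the stated terms. -/
theorem map_sum_sgd_sub_eq {Ω 𝒳 H : Type*} [MeasurableSpace 𝒳] [NormedAddCommGroup H]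
    [InnerProductSpace ℝ H] [CompleteSpace H] (μ : Measure 𝒳) (g : 𝒳 → H → ℝ) {cγ α : ℝ} {p : ℕ}
    (X : Fin p → ℕ → Ω → 𝒳) (m₁ : Fin p → Ω → H) (A : H →L[ℝ] H) (m : H) (hcγ : 0 < cγ)
    (i : Fin p) (n : ℕ) (ω : Ω) :
    A (∑ j ∈ Finset.range (n + 1), (sgd g cγ α (m₁ i ω) (fun l => X i l ω) (j + 1) - m)) =
      drift cγ α (fun k ω => sgd g cγ α (m₁ i ω) (fun l => X i l ω) k - m)
        (fun k ω => gradient (objective μ g) (sgd g cγ α (m₁ i ω) (fun l => X i l ω) k)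
          - A (sgd g cγ α (m₁ i ω) (fun l => X i l ω) k - m)) n ω
      - ∑ j ∈ Finset.range (n + 1), gradientNoise μ g cγ α X m₁ i j ω := by
  set u := sgd g cγ α (m₁ i ω) (fun l => X i l ω) with hu
  have h1 := sum_smul_sub_succ (fun k : ℕ => cγ⁻¹ * (k : ℝ) ^ α) (fun k => u k - m) n
  have h2 : ∀ j : ℕ, (cγ⁻¹ * ((j + 1 : ℕ) : ℝ) ^ α) • ((u (j + 1) - m) - (u (j + 2) - m))
      = gradient (g (X i (j + 2) ω)) (u (j + 1)) := by
    intro j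
    have h3 : u (j + 2) = u (j + 1)
        - stepSize cγ α (j + 1) • gradient (g (X i (j + 2) ω)) (u (j + 1)) := rfl
    have h4 : cγ⁻¹ * ((j + 1 : ℕ) : ℝ) ^ α * stepSize cγ α (j + 1) = 1 := by
      rw [stepSize, Real.rpow_neg (by positivity)]
      have : ((j + 1 : ℕ) : ℝ) ^ α ≠ 0 := by positivity
      field_simp
    rw [h3, sub_sub_sub_cancel_right, sub_sub_cancel, smul_smul, h4, one_smul]
  simp only [h2] at h1
  have h5 : drift cγ α (fun k ω => sgd g cγ α (m₁ i ω) (fun l => X i l ω) k - m)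
        (fun k ω => gradient (objective μ g) (sgd g cγ α (m₁ i ω) (fun l => X i l ω) k)
          - A (sgd g cγ α (m₁ i ω) (fun l => X i l ω) k - m)) n ω
      = ∑ j ∈ Finset.range (n + 1), gradient (g (X i (j + 2) ω)) (u (j + 1))
        - ∑ j ∈ Finset.range (n + 1), (gradient (objective μ g) (u (j + 1)) - A (u (j + 1) - m)) := by
    rw [h1]
    simp [drift, hu]
  rw [h5, map_sum, ← Finset.sum_sub_distrib, ← Finset.sum_sub_distrib]
  refine Finset.sum_congr rfl fun j _ => ?_
  rw [gradientNoise, ← hu]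
  abel

theorem IsMachineData.measurable_sgd {H : Type*} [NormedAddCommGroup H] [InnerProductSpace ℝ H]
    [CompleteSpace H] [SecondCountableTopology H] [MeasurableSpace H] [BorelSpace H] {𝒳 : Type*}
    [MeasurableSpace 𝒳] {μ : Measure 𝒳} {g : 𝒳 → H → ℝ} {m : H} {L : ℕ → ℝ} {Ω : Type*}
    [MeasurableSpace Ω] {P : Measure Ω} {R cγ α : ℝ} {p : ℕ} {X : Fin p → ℕ → Ω → 𝒳}
    {m₁ : Fin p → Ω → H} (hD : IsMachineData P μ R X m₁)
    (ho : IsGradientOracle μ g m L) (i : Fin p) {k : ℕ} (hk : 1 ≤ k) :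
    Measurable (fun ω => sgd g cγ α (m₁ i ω) (fun l => X i l ω) k) := by
  obtain ⟨k, rfl⟩ : ∃ k', k = k' + 1 := ⟨k - 1, by omega⟩
  exact _root_.measurable_sgd ho.measurable (hD.measurable_start i) k
    fun l _ => hD.measurable_data i _ (by omega)

section Noise

variable {H : Type*} [NormedAddCommGroup H] [InnerProductSpace ℝ H] [CompleteSpace H]
  [SecondCountableTopology H] [MeasurableSpace H] [BorelSpace H]
  {𝒳 : Type*} [MeasurableSpace 𝒳] {μ : Measure 𝒳} [IsProbabilityMeasure μ] {g : 𝒳 → H → ℝ}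
  {m : H} {L : ℕ → ℝ} {Ω : Type*} [MeasurableSpace Ω] {P : Measure Ω} [IsProbabilityMeasure P]
  {R cγ α : ℝ} {p : ℕ} {X : Fin p → ℕ → Ω → 𝒳} {m₁ : Fin p → Ω → H}

/-- A variance is at most the second moment, so the noise keeps the constant L₁ that appears in the
leading term. -/
theorem IsGradientOracle.integral_sq_noise_le (ho : IsGradientOracle μ g m L) (y : H) :
    Integrable (fun x => ‖gradient (g x) y - gradient (objective μ g) y‖ ^ 2) μ ∧
    ∫ x, ‖gradient (g x) y - gradient (objective μ g) y‖ ^ 2 ∂μ ≤ L 1 * (1 + ‖y - m‖ ^ 2) := by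
  have hm := ho.memLp_two y
  have hi : Integrable (fun x => gradient (g x) y) μ := hm.integrable (by norm_num)
  have hs : Integrable (fun x => ‖gradient (g x) y‖ ^ 2) μ := by
    simpa using ho.integrable 1 le_rfl y
  have hl := ho.integral_le 1 le_rfl y
  rw [mul_one] at hl
  set F := gradient (objective μ g) y with hF
  have e : ∀ x, ‖gradient (g x) y - F‖ ^ 2
      = (‖gradient (g x) y‖ ^ 2 - 2 * ⟪F, gradient (g x) y⟫) + ‖F‖ ^ 2 := fun x => by
    rw [norm_sub_sq_real, real_inner_comm]
  simp_rw [e]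
  have hj := (hi.const_inner F (𝕜 := ℝ)).const_mul (2 : ℝ)
  have hk : Integrable (fun x => ‖gradient (g x) y‖ ^ 2 - 2 * ⟪F, gradient (g x) y⟫) μ := hs.sub hj
  refine ⟨hk.add (integrable_const _), ?_⟩
  rw [integral_add hk (integrable_const _), integral_sub hs hj, integral_const_mul,
    integral_inner hi, ← ho.unbiased, ← hF, real_inner_self_eq_norm_sq]
  simp only [integral_const, probReal_univ, smul_eq_mul, one_mul]
  nlinarith [sq_nonneg ‖F‖]

theorem IsGradientOracle.measurable_noise (ho : IsGradientOracle μ g m L) :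
    Measurable (fun z : 𝒳 × H => gradient (g z.1) z.2 - gradient (objective μ g) z.2) :=
  ho.measurable.sub (ho.measurable_gradient.comp measurable_snd)

theorem IsMachineData.memLp_gradientNoise (hD : IsMachineData P μ R X m₁)
    (ho : IsGradientOracle μ g m L) (i : Fin p) (k : ℕ)
    (hint : Integrable
      (fun ω => ‖sgd g cγ α (m₁ i ω) (fun l => X i l ω) (k + 1) - m‖ ^ 2) P) :
    MemLp (gradientNoise μ g cγ α X m₁ i k) 2 P ∧
    ∫ ω, ‖gradientNoise μ g cγ α X m₁ i k ω‖ ^ 2 ∂P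
      ≤ L 1 * (1 + ∫ ω, ‖sgd g cγ α (m₁ i ω) (fun l => X i l ω) (k + 1) - m‖ ^ 2 ∂P) := by
  have hX : Measurable (X i (k + 2)) := hD.measurable_data i _ (by omega)
  have hT : Measurable (fun ω => sgd g cγ α (m₁ i ω) (fun l => X i l ω) (k + 1)) :=
    hD.measurable_sgd ho i (by omega)
  have h1 := IndepFun.integral_le_of_integral_le hX hT (hD.indepFun_sgd ho.measurable i k)
    (f := fun z => ‖gradient (g z.1) z.2 - gradient (objective μ g) z.2‖ ^ 2)
    (ho.measurable_noise.norm.pow_const 2) (fun z => by positivity)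
    (ψ := fun y => L 1 * (1 + ‖y - m‖ ^ 2)) (((integrable_const 1).add hint).const_mul (L 1))
    (by fun_prop) (by rw [hD.law_data i _ (by omega)]; exact fun y => (ho.integral_sq_noise_le y).1)
    (by rw [hD.law_data i _ (by omega)]; exact fun y => (ho.integral_sq_noise_le y).2)
  have hm : Measurable (gradientNoise μ g cγ α X m₁ i k) :=
    ho.measurable_noise.comp (hX.prodMk hT)
  refine ⟨(memLp_two_iff_integrable_sq_norm hm.aestronglyMeasurable).2 h1.1, h1.2.trans_eq ?_⟩
  rw [integral_const_mul, integral_add (integrable_const 1) hint]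
  simp

/-- Given everything else in the product, the item X_{j,l+2} is fresh, and integrating it out
annihilates the second factor. Between different machines no order of the steps is needed. -/
theorem IsMachineData.integral_inner_gradientNoise_of_lt (hD : IsMachineData P μ R X m₁)
    (ho : IsGradientOracle μ g m L) {i j : Fin p} {k l : ℕ} (hne : i ≠ j ∨ k < l)
    (hi : MemLp (gradientNoise μ g cγ α X m₁ i k) 2 P)
    (hj : MemLp (gradientNoise μ g cγ α X m₁ j l) 2 P) :
    ∫ ω, ⟪gradientNoise μ g cγ α X m₁ i k ω, gradientNoise μ g cγ α X m₁ j l ω⟫ ∂P = 0 := by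
  have hX : ∀ i k, Measurable (X i (k + 2)) := fun i k => hD.measurable_data i _ (by omega)
  have hT : ∀ i k, Measurable (fun ω => sgd g cγ α (m₁ i ω) (fun l => X i l ω) (k + 1)) :=
    fun i k => hD.measurable_sgd ho i (by omega)
  refine IndepFun.integral_eq_zero_of_integral_eq_zero (hX j l)
    ((hT j l).prodMk ((hX i k).prodMk (hT i k))) (hD.indepFun_sgd_prod ho.measurable hne)
    (f := fun z => ⟪gradient (g z.2.2.1) z.2.2.2 - gradient (objective μ g) z.2.2.2,
      gradient (g z.1) z.2.1 - gradient (objective μ g) z.2.1⟫)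
    ((ho.measurable_noise.comp (measurable_snd.comp measurable_snd)).inner
      (ho.measurable_noise.comp (measurable_fst.prodMk (measurable_fst.comp measurable_snd))))
    (integrable_inner_of_memLp_two hi hj) fun y => ?_
  rw [hD.law_data j _ (by omega)]
  have hi : Integrable (fun x => gradient (g x) y.1) μ :=
    (ho.memLp_two y.1).integrable (by norm_num)
  have hsub : Integrable (fun x => gradient (g x) y.1 - gradient (objective μ g) y.1) μ :=
    hi.sub (integrable_const _)
  simp only
  rw [integral_inner hsub, integral_sub hi (integrable_const _),
    ← ho.unbiased]
  simp

theorem IsMachineData.integral_inner_gradientNoise (hD : IsMachineData P μ R X m₁)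
    (ho : IsGradientOracle μ g m L) {i j : Fin p} {k l : ℕ} (hne : (i, k) ≠ (j, l))
    (hi : MemLp (gradientNoise μ g cγ α X m₁ i k) 2 P)
    (hj : MemLp (gradientNoise μ g cγ α X m₁ j l) 2 P) :
    ∫ ω, ⟪gradientNoise μ g cγ α X m₁ i k ω, gradientNoise μ g cγ α X m₁ j l ω⟫ ∂P = 0 := by
  by_cases h : i ≠ j ∨ k < l
  · exact hD.integral_inner_gradientNoise_of_lt ho h hi hj
  · push Not at h
    have hlk : l < k := lt_of_le_of_ne h.2 fun hlk => hne (by rw [h.1, hlk])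
    rw [← hD.integral_inner_gradientNoise_of_lt ho (.inr hlk) hj hi]
    exact integral_congr_ae (.of_forall fun ω => real_inner_comm _ _)

end Noise

theorem pasg_sub_eq {H : Type*} [NormedAddCommGroup H] [InnerProductSpace ℝ H] [CompleteSpace H]
    {𝒳 : Type*} (g : 𝒳 → H → ℝ) (cγ α : ℝ) {p : ℕ} (m : H) (m₁ : Fin p → H) (x : Fin p → ℕ → 𝒳)
    {n : Fin p → ℕ} (hn : ∀ i, 1 ≤ n i) (hN : 0 < ∑ i, n i) :
    pasg g cγ α m₁ x n - m = (1 / ((∑ i, n i : ℕ) : ℝ)) •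
      ∑ i, ∑ j ∈ Finset.range (n i), (sgd g cγ α (m₁ i) (x i) (j + 1) - m) := by
  have h1 : ((∑ i, n i : ℕ) : ℝ) ≠ 0 := by exact_mod_cast hN.ne'
  have h2 : ∑ i, ∑ j ∈ Finset.range (n i), (sgd g cγ α (m₁ i) (x i) (j + 1) - m)
      = ∑ i, (n i : ℝ) • runningAverage (sgd g cγ α (m₁ i) (x i)) (n i)
        - ((∑ i, n i : ℕ) : ℝ) • m := by
    push_cast
    rw [Finset.sum_smul, ← Finset.sum_sub_distrib]
    refine Finset.sum_congr rfl fun i _ => ?_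
    rw [Finset.sum_sub_distrib, natCast_smul_runningAverage _ (hn i)]
    simp [Nat.cast_smul_eq_nsmul]
  rw [h2, smul_sub, smul_smul, one_div_mul_cancel h1, one_smul, pasg]

theorem memLp_two_of_integrable_sq {Ω H : Type*} [MeasurableSpace Ω] {P : Measure Ω}
    [NormedAddCommGroup H] [MeasurableSpace H] [BorelSpace H] [SecondCountableTopology H] {f : Ω → H} (hf : Measurable f)
    (h : Integrable (fun ω => ‖f ω‖ ^ 2) P) : MemLp f 2 P :=
  (memLp_two_iff_integrable_sq_norm hf.aestronglyMeasurable).2 h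

section Average

variable {H : Type*} [NormedAddCommGroup H] [InnerProductSpace ℝ H] [CompleteSpace H]
  [SecondCountableTopology H] [MeasurableSpace H] [BorelSpace H]
  {𝒳 : Type*} [MeasurableSpace 𝒳] {μ : Measure 𝒳} [IsProbabilityMeasure μ] {g : 𝒳 → H → ℝ}
  {m : H} {L : ℕ → ℝ} {Ω : Type*} [MeasurableSpace Ω] {P : Measure Ω} [IsProbabilityMeasure P]
  {R cγ α : ℝ} {p : ℕ} {X : Fin p → ℕ → Ω → 𝒳} {m₁ : Fin p → Ω → H}

/-- The mean square of the total gradient noise. -/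
theorem IsMachineData.integral_sq_sum_gradientNoise_le (hD : IsMachineData P μ R X m₁)
    (ho : IsGradientOracle μ g m L) {c₁ : ℝ} (hc₁ : 0 ≤ c₁) (hα : 0 < α) (hα' : α < 1)
    (h2 : ∀ (i : Fin p) (k : ℕ), 1 ≤ k →
      Integrable (fun ω => ‖sgd g cγ α (m₁ i ω) (fun l => X i l ω) k - m‖ ^ 2) P ∧
      ∫ ω, ‖sgd g cγ α (m₁ i ω) (fun l => X i l ω) k - m‖ ^ 2 ∂P ≤ c₁ * (k : ℝ) ^ (-α))
    (n : Fin p → ℕ) :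
    MemLp (fun ω => ∑ i, ∑ j ∈ Finset.range (n i), gradientNoise μ g cγ α X m₁ i j ω) 2 P ∧
    ∫ ω, ‖∑ i, ∑ j ∈ Finset.range (n i), gradientNoise μ g cγ α X m₁ i j ω‖ ^ 2 ∂P
      ≤ L 1 * (((∑ i, n i : ℕ) : ℝ) + c₁ * ((p : ℝ) ^ α * ((∑ i, n i : ℕ) : ℝ) ^ (1 - α)
        / (1 - α))) := by
  have hL := (ho.pos 1 le_rfl).le
  have h1α : 0 < 1 - α := by linarith
  have hξ : ∀ i k, MemLp (gradientNoise μ g cγ α X m₁ i k) 2 P := fun i k =>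
    (hD.memLp_gradientNoise ho i k (h2 i _ (by omega)).1).1
  refine ⟨memLp_finsetSum _ fun i _ => memLp_finsetSum _ fun j _ => hξ i j, ?_⟩
  -- Machines and steps are indexed jointly, so that all noises form a single orthogonal family.
  have h3 := integral_norm_sq_sum_of_orthogonal (P := P)
    (Finset.univ.sigma fun i => Finset.range (n i))
    (f := fun (q : (_ : Fin p) × ℕ) => gradientNoise μ g cγ α X m₁ q.1 q.2)
    (fun q _ => hξ _ _) (fun q _ r _ hqr => hD.integral_inner_gradientNoise ho (by
      intro h
      simp only [Prod.mk.injEq] at h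
      exact hqr (Sigma.ext h.1 (heq_of_eq h.2))) (hξ _ _) (hξ _ _))
  simp only [Finset.sum_sigma] at h3
  rw [h3]
  have h4 : ∀ i, ∑ j ∈ Finset.range (n i), ∫ ω, ‖gradientNoise μ g cγ α X m₁ i j ω‖ ^ 2 ∂P
      ≤ L 1 * (n i + c₁ * ((n i : ℝ) ^ (1 - α) / (1 - α))) := by
    intro i
    calc _ ≤ ∑ j ∈ Finset.range (n i), L 1 * (1 + c₁ * ((j + 1 : ℕ) : ℝ) ^ (-α)) := by
          refine Finset.sum_le_sum fun j _ => ?_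
          refine (hD.memLp_gradientNoise ho i j (h2 i _ (by omega)).1).2.trans ?_
          gcongr
          exact (h2 i (j + 1) (by omega)).2
      _ = L 1 * (n i + c₁ * ∑ j ∈ Finset.range (n i), ((j + 1 : ℕ) : ℝ) ^ (-α)) := by
          rw [← Finset.mul_sum, Finset.sum_add_distrib, Finset.mul_sum]
          simp
      _ ≤ _ := by
          gcongr
          exact sum_range_rpow_neg_le hα.le hα' (n i)
  refine (Finset.sum_le_sum fun i _ => h4 i).trans ?_
  rw [← Finset.mul_sum, Finset.sum_add_distrib, ← Finset.mul_sum, ← Finset.sum_div, Nat.cast_sum]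
  gcongr
  have := sum_rpow_le_card_rpow_mul h1α (by linarith) n
  rwa [sub_sub_cancel, Nat.cast_sum] at this

/-- The mean square error of the averaged estimate. -/
theorem IsMachineData.integral_sq_pasg_sub_le (hD : IsMachineData P μ R X m₁)
    (ho : IsGradientOracle μ g m L) {A : H →L[ℝ] H} {lam Cm c₁ c₂ : ℝ} (hlam : 0 < lam)
    (hA : ∀ v, lam * ‖v‖ ^ 2 ≤ ⟪A v, v⟫) (hCm : 0 ≤ Cm)
    (hquad : ∀ h, ‖gradient (objective μ g) h - A (h - m)‖ ≤ Cm * ‖h - m‖ ^ 2)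
    (hc₁ : 0 ≤ c₁) (hc₂ : 0 ≤ c₂) (hcγ : 0 < cγ) (hα : 1 / 2 < α) (hα' : α < 1)
    (h2 : ∀ (i : Fin p) (k : ℕ), 1 ≤ k →
      Integrable (fun ω => ‖sgd g cγ α (m₁ i ω) (fun l => X i l ω) k - m‖ ^ 2) P ∧
      ∫ ω, ‖sgd g cγ α (m₁ i ω) (fun l => X i l ω) k - m‖ ^ 2 ∂P ≤ c₁ * (k : ℝ) ^ (-α))
    (h4 : ∀ (i : Fin p) (k : ℕ), 1 ≤ k →
      Integrable (fun ω => ‖sgd g cγ α (m₁ i ω) (fun l => X i l ω) k - m‖ ^ 4) P ∧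
      ∫ ω, ‖sgd g cγ α (m₁ i ω) (fun l => X i l ω) k - m‖ ^ 4 ∂P ≤ c₂ * (k : ℝ) ^ (-(2 * α)))
    {n : Fin p → ℕ} (hn : ∀ i, 1 ≤ n i) (hp : 1 ≤ p) :
    Integrable (fun ω =>
      ‖pasg g cγ α (fun i => m₁ i ω) (fun i l => X i l ω) n - m‖ ^ 2) P ∧
    ∫ ω, ‖pasg g cγ α (fun i => m₁ i ω) (fun i l => X i l ω) n - m‖ ^ 2 ∂P
      ≤ quadraticBound lam cγ α Cm (L 1) (9 * c₁) c₂ p (∑ i, n i) := by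
  have hL := (ho.pos 1 le_rfl).le
  have hα0 : 0 < α := by linarith
  have h1α : 0 < 1 - α := by linarith
  have hN : 0 < ∑ i, n i :=
    lt_of_lt_of_le (hn ⟨0, hp⟩) (Finset.single_le_sum (fun i _ => Nat.zero_le (n i)) (Finset.mem_univ _))
  set N := ∑ i, n i with hNdef
  have hN0 : (0 : ℝ) < N := by exact_mod_cast hN
  set T : Fin p → ℕ → Ω → H := fun i k ω => sgd g cγ α (m₁ i ω) (fun l => X i l ω) k - m with hTdef
  set δ : Fin p → ℕ → Ω → H := fun i k ω =>
    gradient (objective μ g) (sgd g cγ α (m₁ i ω) (fun l => X i l ω) k)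
      - A (sgd g cγ α (m₁ i ω) (fun l => X i l ω) k - m) with hδdef
  have hTm : ∀ i k, 1 ≤ k → Measurable (T i k) := fun i k hk =>
    (hD.measurable_sgd ho i hk).sub_const m
  have hδm : ∀ i k, 1 ≤ k → Measurable (δ i k) := fun i k hk =>
    (ho.measurable_gradient.comp (hD.measurable_sgd ho i hk)).sub
      (A.continuous.measurable.comp (hTm i k hk))
  have hT : ∀ i k, 1 ≤ k → MemLp (T i k) 2 P := fun i k hk =>
    memLp_two_of_integrable_sq (hTm i k hk) (h2 i k hk).1
  have hTb : ∀ i, ∀ k : ℕ, 1 ≤ k → lpNorm (T i k) 2 P ≤ √c₁ * (k : ℝ) ^ (-(α / 2)) := by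
    intro i k hk
    rw [lpNorm_two_eq_sqrt (hTm i k hk).aestronglyMeasurable]
    refine Real.sqrt_le_iff.2 ⟨by positivity, (h2 i k hk).2.trans (le_of_eq ?_)⟩
    rw [mul_pow, Real.sq_sqrt hc₁, ← Real.rpow_natCast ((k : ℝ) ^ _), ← Real.rpow_mul (by positivity)]
    push_cast; ring_nf
  have hδle : ∀ i k ω, ‖δ i k ω‖ ^ 2 ≤ Cm ^ 2 * ‖T i k ω‖ ^ 4 := fun i k ω => by
    have := pow_le_pow_left₀ (norm_nonneg _)
      (hquad (sgd g cγ α (m₁ i ω) (fun l => X i l ω) k)) 2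
    rw [mul_pow, ← pow_mul] at this
    exact this
  have hδi : ∀ i k, 1 ≤ k → Integrable (fun ω => ‖δ i k ω‖ ^ 2) P := fun i k hk =>
    ((h4 i k hk).1.const_mul (Cm ^ 2)).mono' ((hδm i k hk).norm.pow_const 2).aestronglyMeasurable
      (.of_forall fun ω => by rw [Real.norm_of_nonneg (by positivity)]; exact hδle i k ω)
  have hδ : ∀ i k, 1 ≤ k → MemLp (δ i k) 2 P := fun i k hk =>
    memLp_two_of_integrable_sq (hδm i k hk) (hδi i k hk)
  have hδb : ∀ i, ∀ k : ℕ, 1 ≤ k → lpNorm (δ i k) 2 P ≤ Cm * √c₂ * (k : ℝ) ^ (-α) := by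
    intro i k hk
    rw [lpNorm_two_eq_sqrt (hδm i k hk).aestronglyMeasurable]
    refine Real.sqrt_le_iff.2 ⟨by positivity, ?_⟩
    calc _ ≤ Cm ^ 2 * ∫ ω, ‖T i k ω‖ ^ 4 ∂P := by
          rw [← integral_const_mul]
          exact integral_mono (hδi i k hk) ((h4 i k hk).1.const_mul (Cm ^ 2)) (hδle i k)
      _ ≤ Cm ^ 2 * (c₂ * (k : ℝ) ^ (-(2 * α))) := by
          gcongr
          exact (h4 i k hk).2
      _ = _ := by
          rw [mul_pow, mul_pow, Real.sq_sqrt hc₂, ← Real.rpow_natCast ((k : ℝ) ^ _),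
            ← Real.rpow_mul (by positivity)]
          push_cast; ring_nf
  -- `drift` at index n comes from n + 1 steps, hence the index n_i - 1.
  have hDm : ∀ i, MemLp (drift cγ α (T i) (δ i) (n i - 1)) 2 P := fun i =>
    memLp_drift (hT i) (hδ i) _
  have hDb : ∀ i, lpNorm (drift cγ α (T i) (δ i) (n i - 1)) 2 P ≤ cγ⁻¹ * √c₁
      + 3 * (cγ⁻¹ * √c₁ * (n i : ℝ) ^ (α / 2))
      + Cm * √c₂ * ((n i : ℝ) ^ (1 - α) / (1 - α)) := fun i => by
    have := lpNorm_drift_le hcγ hα0.le hα' (Real.sqrt_nonneg c₁) (by positivity) (hT i) (hδ i)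
      (hTb i) (hδb i) (n i - 1)
    rwa [Nat.sub_add_cancel (hn i)] at this
  obtain ⟨hWm, hWb⟩ := hD.integral_sq_sum_gradientNoise_le ho hc₁ hα0 hα' h2 n
  set W : Ω → H := fun ω =>
    ∑ i, ∑ j ∈ Finset.range (n i), gradientNoise μ g cγ α X m₁ i j ω with hW
  set S : Ω → H := fun ω => ∑ i, ∑ j ∈ Finset.range (n i), T i (j + 1) ω with hS
  have hSm : MemLp S 2 P := memLp_finsetSum _ fun i _ => memLp_finsetSum _ fun j _ =>
    hT i _ (by omega)
  have hAS : ∀ ω, A (S ω) = (∑ i, drift cγ α (T i) (δ i) (n i - 1) - W) ω := by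
    intro ω
    rw [Pi.sub_apply, Finset.sum_apply, hS, hW, map_sum, ← Finset.sum_sub_distrib]
    refine Finset.sum_congr rfl fun i _ => ?_
    have := map_sum_sgd_sub_eq (α := α) μ g X m₁ A m hcγ i (n i - 1) ω
    rwa [Nat.sub_add_cancel (hn i)] at this
  -- Cauchy–Schwarz turns the lower bound on the quadratic form into one on the norm, so no inverse
  -- of A is needed.
  have hSA : ∀ v, lam * ‖v‖ ≤ ‖A v‖ := fun v => by
    rcases (norm_nonneg v).eq_or_lt with h | h
    · rw [← h, mul_zero]; exact norm_nonneg _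
    · have h5 := (hA v).trans (real_inner_le_norm _ _)
      rw [sq, ← mul_assoc] at h5
      exact le_of_mul_le_mul_right h5 h
  have hDsum : MemLp (∑ i, drift cγ α (T i) (δ i) (n i - 1)) 2 P :=
    memLp_finsetSum' _ fun i _ => hDm i
  have h5 : lam * lpNorm S 2 P ≤ lpNorm (∑ i, drift cγ α (T i) (δ i) (n i - 1) - W) 2 P := by
    have h6 : lpNorm (lam • S) 2 P = lam * lpNorm S 2 P := by
      rw [lpNorm_const_smul, coe_nnnorm, Real.norm_of_nonneg hlam.le]
    rw [← h6, ← lpNorm_norm (hDsum.sub hWm).1]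
    refine lpNorm_mono_real (hDsum.sub hWm).norm fun ω => ?_
    rw [← hAS, Pi.smul_apply, norm_smul, Real.norm_of_nonneg hlam.le]
    exact hSA _
  have h6 : lpNorm W 2 P
      ≤ √(L 1 * (N + c₁ * ((p : ℝ) ^ α * (N : ℝ) ^ (1 - α) / (1 - α)))) := by
    rw [lpNorm_two_eq_sqrt hWm.1]
    exact Real.sqrt_le_sqrt hWb
  have h7 : ∑ i, lpNorm (drift cγ α (T i) (δ i) (n i - 1)) 2 P ≤ p * (cγ⁻¹ * √c₁)
        + 3 * (cγ⁻¹ * √c₁ * ((p : ℝ) ^ (1 - α / 2) * (N : ℝ) ^ (α / 2)))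
        + Cm * √c₂ * ((p : ℝ) ^ α * (N : ℝ) ^ (1 - α) / (1 - α)) := by
    refine (Finset.sum_le_sum fun i _ => hDb i).trans ?_
    have e : ∑ i, (cγ⁻¹ * √c₁ + 3 * (cγ⁻¹ * √c₁ * (n i : ℝ) ^ (α / 2))
        + Cm * √c₂ * ((n i : ℝ) ^ (1 - α) / (1 - α)))
        = p * (cγ⁻¹ * √c₁) + 3 * (cγ⁻¹ * √c₁ * ∑ i, (n i : ℝ) ^ (α / 2))
          + Cm * √c₂ * ((∑ i, (n i : ℝ) ^ (1 - α)) / (1 - α)) := by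
      simp only [Finset.sum_add_distrib, Finset.mul_sum, Finset.sum_div, Finset.sum_const,
        Finset.card_univ, Fintype.card_fin, nsmul_eq_mul]
    rw [e]
    have k1 := sum_rpow_le_card_rpow_mul (s := α / 2) (by linarith) (by linarith) n
    have k2 := sum_rpow_le_card_rpow_mul h1α (by linarith) n
    rw [sub_sub_cancel] at k2
    gcongr
  have h8 : lam * lpNorm S 2 P ≤ p * (cγ⁻¹ * √c₁)
        + 3 * (cγ⁻¹ * √c₁ * ((p : ℝ) ^ (1 - α / 2) * (N : ℝ) ^ (α / 2)))
        + Cm * √c₂ * ((p : ℝ) ^ α * (N : ℝ) ^ (1 - α) / (1 - α))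
        + √(L 1 * (N + c₁ * ((p : ℝ) ^ α * (N : ℝ) ^ (1 - α) / (1 - α)))) := by
    have k1 := lpNorm_sub_le hDsum (by norm_num : (1 : ENNReal) ≤ 2) (g := W)
    have k2 := lpNorm_sum_le (fun i (_ : i ∈ Finset.univ) => hDm i)
      (by norm_num : (1 : ENNReal) ≤ 2)
    linarith
  have hpasg : (fun ω => pasg g cγ α (fun i => m₁ i ω) (fun i l => X i l ω) n - m)
      = (1 / (N : ℝ)) • S := funext fun ω =>
    pasg_sub_eq g cγ α m (fun i => m₁ i ω) (fun i l => X i l ω) hn hN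
  have hmem : MemLp (fun ω => pasg g cγ α (fun i => m₁ i ω) (fun i l => X i l ω) n - m) 2 P := by
    rw [hpasg]; exact hSm.const_smul _
  have hint := (memLp_two_iff_integrable_sq_norm hmem.1).1 hmem
  refine ⟨hint, ?_⟩
  have hnorm : lam * lpNorm (fun ω => pasg g cγ α (fun i => m₁ i ω) (fun i l => X i l ω) n - m) 2 P
      ≤ ∑ j, √(remainderSq cγ α Cm (L 1) (9 * c₁) c₂ p N j) := by
    refine le_trans ?_ (bound_le_sum_sqrt_remainderSq hcγ hα hα' hL hc₁ hc₂ hN)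
    rw [hpasg, lpNorm_const_smul, coe_nnnorm, Real.norm_of_nonneg (by positivity),
      mul_left_comm]
    gcongr
  rw [quadraticBound_eq_sq hα0.le hα'.le hL (by positivity) hc₂]
  rw [lpNorm_two_eq_sqrt hmem.1] at hnorm
  have h9 := pow_le_pow_left₀ (by positivity) hnorm 2
  rw [mul_pow, Real.sq_sqrt (integral_nonneg fun ω => by positivity)] at h9
  rw [zpow_neg, ← div_eq_inv_mul, le_div_iff₀ (by positivity), mul_comm]
  exact_mod_cast h9

end Average

/-! ### Asymptotics of the remainder -/

/-- A power of the number of machines over a power of the total sample size is `o(1 / N)`. -/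
theorem isLittleO_rpow_div_rpow {q : ℕ → ℕ} {κ s t : ℝ} (hs : 0 < s) (hst : κ * s ≤ t - 1)
    (hq : (fun N => (q N : ℝ)) =o[atTop] (fun N : ℕ => (N : ℝ) ^ κ)) :
    (fun N : ℕ => (q N : ℝ) ^ s / (N : ℝ) ^ t) =o[atTop] (fun N : ℕ => 1 / (N : ℝ)) := by
  have h1 : (fun N => (q N : ℝ) ^ s) =o[atTop] (fun N : ℕ => ((N : ℝ) ^ κ) ^ s) :=
    hq.rpow hs (.of_forall fun N => by positivity)
  have h2 := h1.mul_isBigO (isBigO_refl (fun N : ℕ => ((N : ℝ) ^ t)⁻¹) atTop)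
  simp only [← div_eq_mul_inv] at h2
  refine h2.trans_isBigO (IsBigO.of_bound 1 ?_)
  filter_upwards [eventually_ge_atTop 1] with N hN
  have hN0 : (0 : ℝ) < N := by exact_mod_cast hN
  rw [one_mul, Real.norm_of_nonneg (by positivity), Real.norm_of_nonneg (by positivity),
    ← Real.rpow_mul hN0.le, ← Real.rpow_sub hN0, one_div, ← Real.rpow_neg_one]
  exact Real.rpow_le_rpow_of_exponent_le (by exact_mod_cast hN) (by linarith)

theorem isLittleO_remainderSq {cγ α Cm L₁ C₁ C₂ : ℝ} (hα : 1 / 2 < α) (hα' : α < 1) {q : ℕ → ℕ}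
    (hq : (fun N => (q N : ℝ)) =o[atTop]
      (fun N : ℕ => (N : ℝ) ^ min ((2 * α - 1) / (2 * α)) ((1 - α) / (2 - α)))) (j : Fin 5) :
    (fun N : ℕ => remainderSq cγ α Cm L₁ C₁ C₂ (q N) N j.castSucc) =o[atTop]
      (fun N : ℕ => 1 / (N : ℝ)) := by
  set κ := min ((2 * α - 1) / (2 * α)) ((1 - α) / (2 - α)) with hκ
  -- The two members of the minimum are the conditions for A_4² and A_3² to be o(1/N); the
  -- conditions κ ≤ 1/2 for A_1², A_2² and κ ≤ 1 for A_5² follow.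
  have k1 : κ * (2 * α) ≤ 2 * α - 1 :=
    (le_div_iff₀ (by linarith)).1 (min_le_left _ _)
  have k2 : κ * (2 - α) ≤ 1 - α := (le_div_iff₀ (by linarith)).1 (min_le_right _ _)
  have k3 : κ * 2 ≤ 1 := by
    have : (1 - α) / (2 - α) ≤ 1 / 2 := by
      rw [div_le_div_iff₀ (by linarith) (by norm_num)]; linarith
    have := (min_le_right ((2 * α - 1) / (2 * α)) ((1 - α) / (2 - α))).trans this
    linarith
  have r2 := isLittleO_rpow_div_rpow (s := (2 : ℕ)) (t := (2 : ℕ)) (by norm_num)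
    (by push_cast; linarith) hq
  simp only [Real.rpow_natCast] at r2
  have r3 := isLittleO_rpow_div_rpow (s := 2 - α) (t := 2 - α) (by linarith) (by linarith) hq
  have r4 := isLittleO_rpow_div_rpow (s := 2 * α) (t := 2 * α) (by linarith) (by linarith) hq
  have r5 := isLittleO_rpow_div_rpow (s := α) (t := 1 + α) (by linarith) (by nlinarith) hq
  match j with
  | 0 =>
    refine (r2.const_mul_left (C₁ * cγ ^ (-2 : ℤ))).congr_left fun N => ?_
    simp only [remainderSq, Fin.castSucc_zero, Matrix.cons_val]
    ring
  | 1 =>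
    refine (r2.const_mul_left (C₁ * cγ ^ (-2 : ℤ))).congr_left fun N => ?_
    change _ = (q N : ℝ) ^ 2 * C₁ * cγ ^ (-2 : ℤ) / (N : ℝ) ^ 2
    ring
  | 2 =>
    refine (r3.const_mul_left (4 * α * cγ ^ (-2 : ℤ) * C₁)).congr_left fun N => ?_
    change _ = 4 * (q N : ℝ) ^ (2 - α) * α * cγ ^ (-2 : ℤ) * C₁ / (N : ℝ) ^ (2 - α)
    ring
  | 3 =>
    refine (r4.const_mul_left (Cm ^ 2 * C₂ * (1 - α) ^ (-2 : ℤ))).congr_left fun N => ?_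
    change _ = Cm ^ 2 * C₂ * (1 - α) ^ (-2 : ℤ) * (q N : ℝ) ^ (2 * α) / (N : ℝ) ^ (2 * α)
    ring
  | 4 =>
    refine (r5.const_mul_left (L₁ * C₁ * (1 - α)⁻¹)).congr_left fun N => ?_
    change _ = L₁ * C₁ * (1 - α)⁻¹ * (q N : ℝ) ^ α / (N : ℝ) ^ (1 + α)
    ring

/-- The explicit bound is `L₁ λ⁻² / N + o(1 / N)`. -/
theorem isLittleO_quadraticBound_sub {lam cγ α Cm L₁ C₁ C₂ : ℝ} (hα : 1 / 2 < α) (hα' : α < 1)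
    {q : ℕ → ℕ}
    (hq : (fun N => (q N : ℝ)) =o[atTop]
      (fun N : ℕ => (N : ℝ) ^ min ((2 * α - 1) / (2 * α)) ((1 - α) / (2 - α)))) :
    (fun N : ℕ => quadraticBound lam cγ α Cm L₁ C₁ C₂ (q N) N - L₁ * lam ^ (-2 : ℤ) / (N : ℝ))
      =o[atTop] (fun N : ℕ => 1 / (N : ℝ)) := by
  have hsmall := isLittleO_remainderSq (cγ := cγ) (Cm := Cm) (L₁ := L₁) (C₁ := C₁) (C₂ := C₂)
    hα hα' hq
  have hsqrt : ∀ j : Fin 5, (fun N : ℕ => √(remainderSq cγ α Cm L₁ C₁ C₂ (q N) N j.castSucc))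
      =o[atTop] (fun N : ℕ => (1 / (N : ℝ)) ^ (1 / 2 : ℝ)) := fun j => by
    simp_rw [Real.sqrt_eq_rpow]
    exact (hsmall j).rpow (by norm_num) (.of_forall fun N => by positivity)
  have hlast : (fun N : ℕ => √(remainderSq cγ α Cm L₁ C₁ C₂ (q N) N (Fin.last 5)))
      =O[atTop] (fun N : ℕ => (1 / (N : ℝ)) ^ (1 / 2 : ℝ)) := by
    simp_rw [Real.sqrt_eq_rpow]
    refine IsBigO.rpow (by norm_num) (.of_forall fun N => by positivity) ?_
    refine ((isBigO_refl (fun N : ℕ => 1 / (N : ℝ)) atTop).const_mul_left L₁).congr_left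
      fun N => ?_
    change _ = L₁ / (N : ℝ)
    ring
  have hbig : ∀ j : Fin 6, (fun N : ℕ => √(remainderSq cγ α Cm L₁ C₁ C₂ (q N) N j))
      =O[atTop] (fun N : ℕ => (1 / (N : ℝ)) ^ (1 / 2 : ℝ)) := fun j => by
    induction j using Fin.lastCases with
    | last => exact hlast
    | cast j => exact (hsqrt j).isBigO
  have hmul : ∀ N : ℕ, (1 / (N : ℝ)) ^ (1 / 2 : ℝ) * (1 / (N : ℝ)) ^ (1 / 2 : ℝ) = 1 / (N : ℝ) :=
    fun N => by
      rw [← Real.sqrt_eq_rpow]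
      exact Real.mul_self_sqrt (by positivity)
  -- Of two distinct indices at most one is the last, so one factor is o(N^(-1/2)) while the other
  -- is O(N^(-1/2)).
  have hcross : ∀ j : Fin 6, ∀ j' ∈ Finset.univ.erase j, (fun N : ℕ => lam ^ (-2 : ℤ)
      * √(remainderSq cγ α Cm L₁ C₁ C₂ (q N) N j) * √(remainderSq cγ α Cm L₁ C₁ C₂ (q N) N j'))
      =o[atTop] (fun N : ℕ => 1 / (N : ℝ)) := by
    intro j j' hj'
    have hne : j' ≠ j := Finset.ne_of_mem_erase hj'
    have key : (fun N : ℕ => √(remainderSq cγ α Cm L₁ C₁ C₂ (q N) N j)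
        * √(remainderSq cγ α Cm L₁ C₁ C₂ (q N) N j')) =o[atTop] (fun N : ℕ => 1 / (N : ℝ)) := by
      refine IsLittleO.congr_right ?_ hmul
      induction j using Fin.lastCases with
      | last =>
        induction j' using Fin.lastCases with
        | last => exact absurd rfl hne
        | cast j' => exact hlast.mul_isLittleO (hsqrt j')
      | cast j => exact (hsqrt j).mul_isBigO (hbig j')
    simpa only [mul_assoc] using key.const_mul_left (lam ^ (-2 : ℤ))
  have hsum := (IsLittleO.sum (s := Finset.univ) fun j _ =>
    (hsmall j).const_mul_left (lam ^ (-2 : ℤ))).add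
    (IsLittleO.sum (s := Finset.univ) fun j _ => IsLittleO.sum (hcross j))
  refine hsum.congr_left fun N => ?_
  simp only [Finset.sum_apply]
  unfold quadraticBound
  ring

/-! ### The main theorem -/

theorem theorem3
    {H : Type*} [NormedAddCommGroup H] [InnerProductSpace ℝ H] [CompleteSpace H]
    [TopologicalSpace.SeparableSpace H] [MeasurableSpace H] [BorelSpace H]
    {𝒳 : Type*} [MeasurableSpace 𝒳] (μ : Measure 𝒳) [IsProbabilityMeasure μ]
    (g : 𝒳 → H → ℝ)
    (hg_int : ∀ h, Integrable (fun x => g x h) μ)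
    (hg_diff : ∀ᵐ x ∂μ, Differentiable ℝ (g x))
    (hg_meas : Measurable (fun z : 𝒳 × H => gradient (g z.1) z.2))
    (hconvex : ConvexOn ℝ Set.univ (objective μ g))
    (m : H)
    (H1 : Differentiable ℝ (objective μ g) ∧ gradient (objective μ g) m = 0)
    (H2 : TwiceContDiffAE (objective μ g) ∧
      ∀ A : ℝ, 0 < A → ∃ C : ℝ, 0 < C ∧ ∀ h ∈ Metric.ball m A,
        DifferentiableAt ℝ (gradient (objective μ g)) h → ‖hessian (objective μ g) h‖ ≤ C)
    (Cm : ℝ) (hCm : 0 < Cm)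
    (H3 : ∀ h, ‖gradient (objective μ g) h - hessian (objective μ g) m (h - m)‖
      ≤ Cm * ‖h - m‖ ^ 2)
    (H7 : LocallyStronglyConvexAt (objective μ g) m)
    (L : ℕ → ℝ)
    (H8 : ∀ q : ℕ, 1 ≤ q → 0 < L q ∧ ∀ h : H,
      Integrable (fun x => ‖gradient (g x) h‖ ^ (2 * q)) μ ∧
      ∫ x, ‖gradient (g x) h‖ ^ (2 * q) ∂μ ≤ L q * (1 + ‖h - m‖ ^ (2 * q)))
    (cγ α : ℝ) (hcγ : 0 < cγ) (hα : 1 / 2 < α) (hα' : α < 1) (R : ℝ) :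
    ∃ C₁ : ℝ, 0 < C₁ ∧ ∃ C₂ : ℝ, 0 < C₂ ∧ ∃ ρ : ℕ → ℕ → ℝ,
      (∀ q : ℕ → ℕ,
        (fun N => (q N : ℝ)) =o[atTop]
          (fun N : ℕ => (N : ℝ) ^ min ((2 * α - 1) / (2 * α)) ((1 - α) / (2 - α))) →
        (fun N => ρ (q N) N) =o[atTop] (fun N : ℕ => 1 / (N : ℝ))) ∧
      ∀ (p : ℕ) (Ω : Type*) [MeasurableSpace Ω] (P : Measure Ω) [IsProbabilityMeasure P]
        (X : Fin p → ℕ → Ω → 𝒳) (m₁ : Fin p → Ω → H), 1 ≤ p → IsMachineData P μ R X m₁ →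
        (∀ i k, 1 ≤ k →
          (Integrable (fun ω => ‖sgd g cγ α (m₁ i ω) (fun l => X i l ω) k - m‖ ^ 2) P ∧
            ∫ ω, ‖sgd g cγ α (m₁ i ω) (fun l => X i l ω) k - m‖ ^ 2 ∂P ≤ C₁ / (k : ℝ) ^ α) ∧
          (Integrable (fun ω => ‖sgd g cγ α (m₁ i ω) (fun l => X i l ω) k - m‖ ^ 4) P ∧
            ∫ ω, ‖sgd g cγ α (m₁ i ω) (fun l => X i l ω) k - m‖ ^ 4 ∂P
              ≤ C₂ / (k : ℝ) ^ (2 * α))) ∧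
        ∀ n : Fin p → ℕ, (∀ i, 1 ≤ n i) →
          Integrable (fun ω =>
            ‖pasg g cγ α (fun i => m₁ i ω) (fun i l => X i l ω) n - m‖ ^ 2) P ∧
          ∫ ω, ‖pasg g cγ α (fun i => m₁ i ω) (fun i l => X i l ω) n - m‖ ^ 2 ∂P
            ≤ quadraticBound (lambdaMin (hessian (objective μ g) m)) cγ α Cm (L 1) C₁ C₂
                p (∑ i, n i) ∧
          ∫ ω, ‖pasg g cγ α (fun i => m₁ i ω) (fun i l => X i l ω) n - m‖ ^ 2 ∂P
            ≤ L 1 * (lambdaMin (hessian (objective μ g) m)) ^ (-2 : ℤ) / ((∑ i, n i : ℕ) : ℝ)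
              + ρ p (∑ i, n i) := by
  have : SecondCountableTopology H := UniformSpace.secondCountable_of_separable H
  have hlam : 0 < lambdaMin (hessian (objective μ g) m) := H7.2.1
  have hL1 : 0 ≤ L 1 := (H8 1 le_rfl).1.le
  have ho : IsGradientOracle μ g m L :=
    { measurable := hg_meas
      unbiased := gradient_objective_eq_integral hg_int hg_diff hg_meas H1.1 hL1
        fun h => by simpa using (H8 1 le_rfl).2 h
      pos := fun q hq => (H8 q hq).1
      integrable := fun q hq h => ((H8 q hq).2 h).1
      integral_le := fun q hq h => ((H8 q hq).2 h).2 }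
  obtain ⟨E, hE, hcoer⟩ := exists_coercive_gradient hconvex H1.1 hlam hCm
    H7.lambdaMin_mul_le_inner H3 H1.2
  obtain ⟨K, U, hK, hsys⟩ := ho.exists_isMomentSystem (R := R) hcoer hcγ
    (by linarith : 0 < α)
  obtain ⟨B₁, hB₁, B₂, hB₂, hrate⟩ := IsMomentSystem.exists_rates
    (c := 2 * (lambdaMin (hessian (objective μ g) m) / 2) * cγ) (U := U) (by positivity) hE.le
    hα hα' hK
  -- The factor 9 is the square of the 3 from the summation by parts. The remainder is the explicit
  -- bound minus its leading term, so it depends on p and n alone.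
  refine ⟨9 * B₁, by positivity, B₂, hB₂,
    fun p n => quadraticBound (lambdaMin (hessian (objective μ g) m)) cγ α Cm (L 1) (9 * B₁) B₂ p n
      - L 1 * (lambdaMin (hessian (objective μ g) m)) ^ (-2 : ℤ) / (n : ℝ),
    fun q hq => isLittleO_quadraticBound_sub hα hα' hq, fun p Ω _ P _ X m₁ hp hD => ?_⟩
  have h2 : ∀ (i : Fin p) (k : ℕ), 1 ≤ k →
      Integrable (fun ω => ‖sgd g cγ α (m₁ i ω) (fun l => X i l ω) k - m‖ ^ 2) P ∧
      ∫ ω, ‖sgd g cγ α (m₁ i ω) (fun l => X i l ω) k - m‖ ^ 2 ∂P ≤ B₁ * (k : ℝ) ^ (-α) :=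
    fun i k hk => by
      obtain ⟨s1, s2⟩ := hsys P X m₁ hD i
      exact ⟨by simpa using s1 1 k hk, by simpa using (hrate _ s2 k hk).1⟩
  have h4 : ∀ (i : Fin p) (k : ℕ), 1 ≤ k →
      Integrable (fun ω => ‖sgd g cγ α (m₁ i ω) (fun l => X i l ω) k - m‖ ^ 4) P ∧
      ∫ ω, ‖sgd g cγ α (m₁ i ω) (fun l => X i l ω) k - m‖ ^ 4 ∂P ≤ B₂ * (k : ℝ) ^ (-(2 * α)) :=
    fun i k hk => by
      obtain ⟨s1, s2⟩ := hsys P X m₁ hD i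
      exact ⟨by simpa [← pow_mul] using s1 2 k hk, by simpa [← pow_mul] using (hrate _ s2 k hk).2⟩
  refine ⟨fun i k hk => ⟨⟨(h2 i k hk).1, (h2 i k hk).2.trans ?_⟩,
    ⟨(h4 i k hk).1, (h4 i k hk).2.trans_eq ?_⟩⟩, fun n hn => ?_⟩
  · rw [Real.rpow_neg (by positivity), ← div_eq_mul_inv]
    gcongr
    linarith
  · rw [Real.rpow_neg (by positivity), ← div_eq_mul_inv]
  · obtain ⟨k1, k2⟩ := hD.integral_sq_pasg_sub_le ho hlam H7.lambdaMin_mul_le_inner hCm.le H3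
      hB₁.le hB₂.le hcγ hα hα' h2 h4 hn hp
    exact ⟨k1, k2, by linarith⟩
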